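/- Let $(X_t)_{t\ge 0}$ be a real-valued process on a probability space with $X_0=0$ a.s. and such that $(e^{X_t})_{t\ge 0}$ is a martingale (with respect to some filtration). For $\kappa\in\mathbb R$, $t>0$ put $$\bar F_t(\kappa)=P(X_t>\kappa),\qquad c(\kappa,t)=E[(e^{X_t}-e^{\kappa})^+],\qquad C_{BS}(\kappa,v)=E[(e^{vZ-v^2/2}-e^{\kappa})^+],\quad Z\sim N(0,1),$$ and let the implied volatility $\sigma_{imp}(\kappa,t)$ be the unique $\sigma\in[0,\infty)$ with $C_{BS}(\kappa,\sigma\sqrt t)=c(\kappa,t)$ (for $\kappa,t>0$ such a $\sigma$ exists and is unique). Consider an arbitrary family of values of $(\kappa,t)$ with $\kappa>0$, $t>0$ and $c(\kappa,t)>0$; all limits are taken along this family, and $f\sim g$ means $f/g\to 1$. Assume that $\bar F_t(\kappa)\to 0$, that for every $\rho\in[1,\infty)$ the limit $$I_+(\rho)=\lim\frac{\log\bar F_t(\rho\kappa)}{\log\bar F_t(\kappa)}\in[0,+\infty]$$ exists (with $\log 0=-\infty$), and that $\lim_{\rho\downarrow1}I_+(\rho)=1$. For $\eta>0$ consider the moment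 conditions $$(\mathrm{M}_\eta)\quad \limsup E[e^{(1+\eta)X_t}]<\infty,\qquad\qquad (\mathrm{M}'_\eta)\quad \limsup E\Big[\Big|\frac{e^{X_t}-1}{\kappa}\Big|^{1+\eta}\Big]<\infty .$$ (i) Suppose $\liminf\kappa>0$ and $\limsup t<\infty$. Assume that either $(\mathrm{M}_\eta)$ holds for every $\eta>0$, or $(\mathrm{M}_\eta)$ holds for some $\eta>0$ and $I_+(\rho)\ge\rho$ for all $\rho\ge1$. Then $$\log c(\kappa,t)\sim\log\bar F_t(\kappa)+\kappa,\qquad \sigma_{imp}(\kappa,t)\sim\left(\sqrt{\frac{-\log\bar F_t(\kappa)}{\kappa}}-\sqrt{\frac{-\log\bar F_t(\kappa)}{\kappa}-1}\right)\sqrt{\frac{2\kappa}{t}}.$$ Special case: if moreover $-\log\bar F_t(\kappa)/\kappa\to\infty$, then the condition "$I_+(\rho)\ge\rho$ for all $\rho\ge1$" can be relaxed to $\lim_{\rho\to\infty}I_+(\rho)=\infty$, and besides the two relations above one has $$\log c(\kappa,t)\sim\log\bar F_t(\kappa),\qquad \sigma_{imp}(\kappa,t)\sim\frac{\kappa}{\sqrt{2t\,(-\log\bar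 F_t(\kappa))}}.$$ (ii) Suppose $\kappa\to0$ and $t\to0$. Assume that either $(\mathrm{M}'_\eta)$ holds for every $\eta>0$, or $(\mathrm{M}'_\eta)$ holds for some $\eta>0$ and $\lim_{\rho\to\infty}I_+(\rho)=\infty$. Then $$\log\big(c(\kappa,t)/\kappa\big)\sim\log\bar F_t(\kappa),\qquad \sigma_{imp}(\kappa,t)\sim\frac{\kappa}{\sqrt{2t\,(-\log\bar F_t(\kappa))}}.$$ -/

import Mathlib

open MeasureTheory ProbabilityTheory Filter Topology
open scoped NNReal ENNReal

noncomputable section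

namespace OptionAsymptotics

/-- `f ∼ g` along the filter `l`: the ratio `f / g` tends to `1`. -/
def RatioEquiv {ι : Type*} (l : Filter ι) (f g : ι → ℝ) : Prop :=
  Tendsto (fun i => f i / g i) l (𝓝 1)

/-- `X` is a risk-neutral log-price under `P`: it starts at `0`, and the price `exp X` is a
martingale. -/
structure IsRiskNeutralLogPrice {Ω : Type*} {mΩ : MeasurableSpace Ω} (P : Measure Ω)
    (ℱ : Filtration ℝ≥0 mΩ) (X : ℝ≥0 → Ω → ℝ) : Prop where
  init : ∀ᵐ ω ∂P, X 0 ω = 0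
  martingale : Martingale (fun t ω => Real.exp (X t ω)) ℱ P

variable {Ω : Type*} [MeasurableSpace Ω]

/-- The right tail probability `P(X_t > κ)`. -/
def rightTail (P : Measure Ω) (X : ℝ≥0 → Ω → ℝ) (κ : ℝ) (t : ℝ≥0) : ℝ≥0∞ :=
  P {ω | κ < X t ω}

/-- The real number `log P(X_t > κ)`, meaningful when the probability is positive. -/
def logTail (P : Measure Ω) (X : ℝ≥0 → Ω → ℝ) (κ : ℝ) (t : ℝ≥0) : ℝ :=
  Real.log (rightTail P X κ t).toReal

/-- The price `E[(e^{X_t} - e^κ)⁺]` of a call option with log-strike `κ` and maturity `t`. -/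
def callPrice (P : Measure Ω) (X : ℝ≥0 → Ω → ℝ) (κ : ℝ) (t : ℝ≥0) : ℝ :=
  ∫ ω, max (Real.exp (X t ω) - Real.exp κ) 0 ∂P

/-- The Black-Scholes call price `E[(e^{v Z - v²/2} - e^κ)⁺]`, with `Z` standard Gaussian. -/
def blackScholesCall (κ v : ℝ) : ℝ :=
  ∫ z, max (Real.exp (v * z - v ^ 2 / 2) - Real.exp κ) 0 ∂(gaussianReal 0 1)

/-- `σ ∈ [0, ∞)` is a volatility parameter for which the Black-Scholes formula yields the call
price of the model. -/
def IsImpliedVolatility (P : Measure Ω) (X : ℝ≥0 → Ω → ℝ) (κ : ℝ) (t : ℝ≥0) (σ : ℝ) : Prop :=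
  0 ≤ σ ∧ blackScholesCall κ (σ * √(t : ℝ)) = callPrice P X κ t

/-- The implied volatility: the unique `σ` with `IsImpliedVolatility P X κ t σ`. -/
def impliedVolatility (P : Measure Ω) (X : ℝ≥0 → Ω → ℝ) (κ : ℝ) (t : ℝ≥0) : ℝ :=
  sInf {σ : ℝ | IsImpliedVolatility P X κ t σ}

/-- Regular decay of the right tail probability along the family `(κ i, τ i)` and the filter `l`,
with limits `I ρ ∈ [0, ∞]`. The logarithms are taken in the extended reals, so that
`log 0 = -∞` and the ratio is `+∞` whenever `P(X_t > ρ κ) = 0 < P(X_t > κ) < 1`. -/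
structure RegularRightDecay (P : Measure Ω) (X : ℝ≥0 → Ω → ℝ) {ι : Type*} (l : Filter ι)
    (κ : ι → ℝ) (τ : ι → ℝ≥0) (I : ℝ → ℝ≥0∞) : Prop where
  tail_tendsto : Tendsto (fun i => rightTail P X (κ i) (τ i)) l (𝓝 0)
  ratio_tendsto : ∀ ρ : ℝ, 1 ≤ ρ →
    Tendsto (fun i => ENNReal.log (rightTail P X (ρ * κ i) (τ i)) /
      ENNReal.log (rightTail P X (κ i) (τ i))) l (𝓝 (I ρ : EReal))
  tendsto_one : Tendsto I (𝓝[>] 1) (𝓝 1)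

/-- `limsup E[e^{(1+η) X_t}] < ∞` along the family. -/
def ExpMomentCondition (P : Measure Ω) (X : ℝ≥0 → Ω → ℝ) {ι : Type*} (l : Filter ι)
    (τ : ι → ℝ≥0) (η : ℝ) : Prop :=
  limsup (fun i => ∫⁻ ω, ENNReal.ofReal (Real.exp ((1 + η) * X (τ i) ω)) ∂P) l < ⊤

/-- `limsup E[|(e^{X_t} - 1) / κ|^{1+η}] < ∞` along the family. -/
def ScaledMomentCondition (P : Measure Ω) (X : ℝ≥0 → Ω → ℝ) {ι : Type*} (l : Filter ι)
    (κ : ι → ℝ) (τ : ι → ℝ≥0) (η : ℝ) : Prop :=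
  limsup (fun i => ∫⁻ ω, ENNReal.ofReal
    (|(Real.exp (X (τ i) ω) - 1) / κ i| ^ (1 + η)) ∂P) l < ⊤

/-- The family satisfies `liminf κ > 0` and `limsup t < ∞`. -/
def StrikeAwayFromZero {ι : Type*} (l : Filter ι) (κ : ι → ℝ) (τ : ι → ℝ≥0) : Prop :=
  (∃ δ : ℝ, 0 < δ ∧ ∀ᶠ i in l, δ ≤ κ i) ∧ ∃ T : ℝ≥0, ∀ᶠ i in l, τ i ≤ T

/-- `(√(a/κ) - √(a/κ - 1)) √(2κ/t)`, with `a = -log P(X_t > κ)`. -/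
def volFormula (P : Measure Ω) (X : ℝ≥0 → Ω → ℝ) (κ : ℝ) (t : ℝ≥0) : ℝ :=
  (√(-logTail P X κ t / κ) - √(-logTail P X κ t / κ - 1)) * √(2 * κ / t)

/-- `κ / √(2 t a)`, with `a = -log P(X_t > κ)`. -/
def simpleVolFormula (P : Measure Ω) (X : ℝ≥0 → Ω → ℝ) (κ : ℝ) (t : ℝ≥0) : ℝ :=
  κ / √(2 * t * (-logTail P X κ t))

end OptionAsymptotics

end

/-! Write `a = -log P(X_t > κ)` and `d = κ/v - v/2`, where `v = σ√t` is the total volatility. The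
theorem compares two logarithmic estimates of the same call price.

Gaussian side: after a change of numéraire the payoff lies in `[0, 1]` and is positive exactly for
`z > d`. Chernoff bounds and `mul_exp_le_blackScholesCall` trap the price between exponentials of
`-d²/2` and `-(d + K)²/2`, so `d ∼ √(2L)`, where `L = -log c` if `κ` stays away from zero and `L =
-log (c/κ)` if `κ → 0`. Solving the quadratic `κ/v - v/2 = d` gives `v = 2κ / (√(d² + 2κ) + d)`, an
expression stable under `∼`; it reduces to `κ/√(2a)` when `L ∼ a` and `κ = o(a)`.

Model side: the price is at least `(e^{ρκ} - e^κ) P(X_t > ρκ)`, and `I ρ → 1` as `ρ ↓ 1` makes this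
sharp on the logarithmic scale (`exists_mul_exp_le_callPrice`). For the upper bound, Hölder's
inequality with a moment of order `1 + η` loses the power `η/(1+η)` of the tail. With all moments
this power is as close to `1` as desired. With a single moment, Hölder is used only beyond a large
multiple `Rκ`, where the tail is small enough to absorb the loss. Between `κ` and `Rκ` the payoff is
`e^{o(a)}` (`exists_setLIntegral_le_exp`) or, if only `I ρ ≥ ρ`, the range is cut into finitely many
thin slabs (`exists_setLIntegral_exp_le`). Markov's inequality keeps `a - κ` above a fixed fraction
of `a`, so that errors `εa` are harmless relative to `a - κ`. -/

noncomputable section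

namespace OptionAsymptotics

/-! ### The Black-Scholes price as a function of total volatility -/

/-- The Black-Scholes call payoff expressed in units of the underlying. -/
def sharePayoff (κ v z : ℝ) : ℝ := max (1 - Real.exp (κ - v * (z + v / 2))) 0

theorem sharePayoff_nonneg (κ v z : ℝ) : 0 ≤ sharePayoff κ v z := le_max_right _ _

theorem sharePayoff_le_one (κ v z : ℝ) : sharePayoff κ v z ≤ 1 :=
  max_le (by linarith [Real.exp_pos (κ - v * (z + v / 2))]) zero_le_one

theorem continuous_sharePayoff (κ : ℝ) : Continuous (fun p : ℝ × ℝ => sharePayoff κ p.1 p.2) := by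
  unfold sharePayoff; fun_prop

theorem integrable_sharePayoff (κ v : ℝ) :
    Integrable (sharePayoff κ v) (gaussianReal 0 1) := by
  refine Integrable.of_bound (C := 1) ?_ (ae_of_all _ fun z => ?_)
  · exact ((continuous_sharePayoff κ).comp
      (by fun_prop : Continuous fun z : ℝ => (v, z))).aestronglyMeasurable
  · rw [Real.norm_of_nonneg (sharePayoff_nonneg _ _ _)]
    exact sharePayoff_le_one _ _ _

/-- Change of numéraire in the Black-Scholes formula. -/
theorem blackScholesCall_eq_integral_sharePayoff (κ v : ℝ) :
    blackScholesCall κ v = ∫ z, sharePayoff κ v z ∂(gaussianReal 0 1) := by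
  unfold blackScholesCall
  rw [integral_gaussianReal_eq_integral_smul one_ne_zero,
    integral_gaussianReal_eq_integral_smul one_ne_zero,
    ← integral_sub_right_eq_self (fun z => gaussianPDFReal 0 1 z • sharePayoff κ v z) v]
  refine integral_congr_ae (ae_of_all _ fun z => ?_)
  have h1 : gaussianPDFReal 0 1 (z - v)
      = gaussianPDFReal 0 1 z * Real.exp (v * z - v ^ 2 / 2) := by
    simp only [gaussianPDFReal_def, mul_assoc, ← Real.exp_add]
    congr 3
    simp
    ring
  have h2 : Real.exp (v * z - v ^ 2 / 2) * Real.exp (κ - v * (z - v + v / 2)) = Real.exp κ := by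
    rw [← Real.exp_add]; congr 1; ring
  simp only [smul_eq_mul, sharePayoff, h1, mul_assoc]
  congr 1
  rw [mul_max_of_nonneg _ _ (Real.exp_pos _).le, mul_sub, h2, mul_one, mul_zero]

/-- Where `z + v/2 ≤ 0` the option with `κ > 0` is worthless at `v`; elsewhere `v (z + v/2)`
increases with `v`. -/
theorem sharePayoff_mono {κ : ℝ} (hκ : 0 < κ) {v w : ℝ} (hv : 0 ≤ v) (hvw : v ≤ w) (z : ℝ) :
    sharePayoff κ v z ≤ sharePayoff κ w z := by
  unfold sharePayoff
  rcases le_total (z + v / 2) 0 with h | h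
  · refine max_le (le_trans ?_ (le_max_right _ _)) (le_max_right _ _)
    have : v * (z + v / 2) ≤ 0 := mul_nonpos_of_nonneg_of_nonpos hv h
    linarith [Real.one_le_exp (show 0 ≤ κ - v * (z + v / 2) by linarith)]
  · refine max_le_max (sub_le_sub_left (Real.exp_le_exp.2 ?_) _) le_rfl
    have : v * (z + v / 2) ≤ w * (z + w / 2) := by
      apply mul_le_mul hvw (by linarith) h (by linarith)
    linarith

theorem sharePayoff_lt {κ : ℝ} (hκ : 0 < κ) {v w : ℝ} (hv : 0 ≤ v) (hvw : v < w) {z : ℝ}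
    (hz : κ / w - w / 2 < z) : sharePayoff κ v z < sharePayoff κ w z := by
  have hw : 0 < w := hv.trans_lt hvw
  have h1 : κ < w * (z + w / 2) := by
    have : κ / w < z + w / 2 := by linarith
    rw [div_lt_iff₀ hw] at this
    linarith
  have h2 : 0 < z + w / 2 := by
    by_contra! h
    nlinarith
  unfold sharePayoff
  have h3 : 0 < 1 - Real.exp (κ - w * (z + w / 2)) := by
    have := Real.exp_lt_exp.2 (show κ - w * (z + w / 2) < 0 by linarith)
    rw [Real.exp_zero] at this
    linarith
  refine max_lt (lt_max_of_lt_left (sub_lt_sub_left (Real.exp_lt_exp.2 ?_) _))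
    (lt_max_of_lt_left h3)
  rcases le_total (z + v / 2) 0 with h | h
  · have : v * (z + v / 2) ≤ 0 := mul_nonpos_of_nonneg_of_nonpos hv h
    linarith
  · nlinarith

theorem gaussianReal_Ioi_pos (x : ℝ) : 0 < gaussianReal 0 1 (Set.Ioi x) := by
  rw [pos_iff_ne_zero]
  intro h
  have := gaussianReal_absolutelyContinuous' 0 one_ne_zero h
  simp at this

/-- The payoffs are ordered pointwise, strictly so beyond the exercise threshold of `w`, a half-line
of positive Gaussian mass. -/
theorem blackScholesCall_strictMonoOn {κ : ℝ} (hκ : 0 < κ) :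
    StrictMonoOn (blackScholesCall κ) (Set.Ici 0) := by
  intro v hv w _ hvw
  have hv : 0 ≤ v := hv
  rw [blackScholesCall_eq_integral_sharePayoff, blackScholesCall_eq_integral_sharePayoff,
    ← sub_pos, ← integral_sub (integrable_sharePayoff κ w) (integrable_sharePayoff κ v),
    integral_pos_iff_support_of_nonneg]
  · refine (gaussianReal_Ioi_pos (κ / w - w / 2)).trans_le (measure_mono fun z hz => ?_)
    exact (sub_pos.2 (sharePayoff_lt hκ hv hvw hz)).ne'
  · exact fun z => sub_nonneg.2 (sharePayoff_mono hκ hv hvw.le z)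
  · exact (integrable_sharePayoff κ w).sub (integrable_sharePayoff κ v)

theorem continuous_blackScholesCall (κ : ℝ) : Continuous (blackScholesCall κ) := by
  have : blackScholesCall κ = fun v => ∫ z, sharePayoff κ v z ∂(gaussianReal 0 1) :=
    funext (blackScholesCall_eq_integral_sharePayoff κ)
  rw [this]
  refine continuous_of_dominated (bound := fun _ => 1)
    (fun v => (integrable_sharePayoff κ v).aestronglyMeasurable)
    (fun v => ae_of_all _ fun z => ?_) (integrable_const _) (ae_of_all _ fun z => ?_)
  · rw [Real.norm_of_nonneg (sharePayoff_nonneg _ _ _)]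
    exact sharePayoff_le_one _ _ _
  · exact (continuous_sharePayoff κ).comp (by fun_prop : Continuous fun v : ℝ => (v, z))

theorem blackScholesCall_zero {κ : ℝ} (hκ : 0 < κ) : blackScholesCall κ 0 = 0 := by
  have : ∀ z, sharePayoff κ 0 z = 0 := fun z => by
    simp only [sharePayoff, zero_mul, sub_zero]
    exact max_eq_right (by linarith [Real.one_le_exp hκ.le])
  simp [blackScholesCall_eq_integral_sharePayoff, this]

/-- The change of numéraire is essential: `e^{vz - v²/2} → 0` pointwise although its mean is `1`,
whereas `sharePayoff` is bounded by `1` and tends to `1`. -/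
theorem tendsto_blackScholesCall_atTop (κ : ℝ) :
    Tendsto (blackScholesCall κ) atTop (𝓝 1) := by
  have : blackScholesCall κ = fun v => ∫ z, sharePayoff κ v z ∂(gaussianReal 0 1) :=
    funext (blackScholesCall_eq_integral_sharePayoff κ)
  rw [this]
  have h1 : (1 : ℝ) = ∫ _z, (1 : ℝ) ∂(gaussianReal 0 1) := by simp
  rw [h1]
  refine tendsto_integral_filter_of_dominated_convergence (fun _ => 1)
    (Eventually.of_forall fun v => (integrable_sharePayoff κ v).aestronglyMeasurable)
    (Eventually.of_forall fun v => ae_of_all _ fun z => ?_) (integrable_const _)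
    (ae_of_all _ fun z => ?_)
  · rw [Real.norm_of_nonneg (sharePayoff_nonneg _ _ _)]
    exact sharePayoff_le_one _ _ _
  · have h2 : Tendsto (fun v : ℝ => v * (z + v / 2)) atTop atTop :=
      tendsto_id.atTop_mul_atTop₀
        (tendsto_atTop_add_const_left _ _ (tendsto_id.atTop_div_const two_pos))
    have h3 : Tendsto (fun v : ℝ => κ - v * (z + v / 2)) atTop atBot :=
      tendsto_atBot_add_const_left _ κ (tendsto_neg_atTop_atBot.comp h2)
    have h4 := (Real.tendsto_exp_atBot.comp h3).const_sub 1
    simpa [sharePayoff] using h4.max (tendsto_const_nhds (x := (0 : ℝ)))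

theorem existsUnique_blackScholesCall_eq {κ : ℝ} (hκ : 0 < κ) {c : ℝ} (hc : 0 < c) (hc1 : c < 1) :
    ∃! v : ℝ, 0 ≤ v ∧ blackScholesCall κ v = c := by
  obtain ⟨w, hw, hw0⟩ := (((tendsto_blackScholesCall_atTop κ).eventually (lt_mem_nhds hc1)).and
    (eventually_ge_atTop 0)).exists
  obtain ⟨v, hv, hvc⟩ := intermediate_value_Icc hw0 (continuous_blackScholesCall κ).continuousOn
    (show c ∈ Set.Icc _ _ from ⟨by rw [blackScholesCall_zero hκ]; exact hc.le, hw.le⟩)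
  refine ⟨v, ⟨hv.1, hvc⟩, fun u hu => ?_⟩
  exact (blackScholesCall_strictMonoOn hκ).injOn hu.1 hv.1 (hu.2.trans hvc.symm)

/-! ### Gaussian bounds on the Black-Scholes price in terms of `d = κ/v - v/2` -/

theorem sharePayoff_eq {κ v : ℝ} (hv : 0 < v) (z : ℝ) :
    sharePayoff κ v z = max (1 - Real.exp (-(v * (z - (κ / v - v / 2))))) 0 := by
  unfold sharePayoff
  congr 3
  field_simp
  ring

theorem integral_exp_gaussian (d : ℝ) :
    ∫ z, Real.exp (d * (z - d)) ∂(gaussianReal 0 1) = Real.exp (-d ^ 2 / 2) := by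
  have h := congrFun (mgf_fun_id_gaussianReal (μ := 0) (v := 1)) d
  simp only [mgf] at h
  have h2 : ∀ z : ℝ, Real.exp (d * (z - d)) = Real.exp (-d ^ 2) * Real.exp (d * z) := fun z => by
    rw [← Real.exp_add]; congr 1; ring
  simp_rw [h2]
  rw [integral_const_mul, h, ← Real.exp_add]
  congr 1
  simp
  ring

theorem integrable_exp_gaussian (d : ℝ) :
    Integrable (fun z => Real.exp (d * (z - d))) (gaussianReal 0 1) := by
  have h2 : ∀ z : ℝ, Real.exp (d * (z - d)) = Real.exp (-d ^ 2) * Real.exp (d * z) := fun z => by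
    rw [← Real.exp_add]; congr 1; ring
  simp_rw [h2]
  exact (integrable_exp_mul_gaussianReal d).const_mul _

/-- Chernoff bound: the payoff vanishes below `d` and is at most `1`, so `e^{d(z-d)}` dominates it.
-/
theorem blackScholesCall_le_exp {κ v : ℝ} (hv : 0 < v) (hd : 0 < κ / v - v / 2) :
    blackScholesCall κ v ≤ Real.exp (-(κ / v - v / 2) ^ 2 / 2) := by
  rw [blackScholesCall_eq_integral_sharePayoff, ← integral_exp_gaussian]
  refine integral_mono (integrable_sharePayoff κ v) (integrable_exp_gaussian _) fun z => ?_
  rw [sharePayoff_eq hv]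
  refine max_le ?_ (Real.exp_pos _).le
  rcases le_total (z - (κ / v - v / 2)) 0 with h | h
  · have := Real.one_le_exp (show 0 ≤ -(v * (z - (κ / v - v / 2))) by nlinarith)
    linarith [Real.exp_pos ((κ / v - v / 2) * (z - (κ / v - v / 2)))]
  · have := Real.one_le_exp (mul_nonneg hd.le h)
    linarith [Real.exp_pos (-(v * (z - (κ / v - v / 2))))]

/-- Uses `1 - e^{-x} ≤ x` for the payoff before the Chernoff bound. The prefactor `v/d` is what
compensates the division by `κ` when `κ → 0`. -/
theorem blackScholesCall_le_div_mul_exp {κ v : ℝ} (hv : 0 < v) (hd : 0 < κ / v - v / 2) :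
    blackScholesCall κ v ≤
      v / (κ / v - v / 2) * Real.exp (-(κ / v - v / 2) ^ 2 / 2) := by
  rw [blackScholesCall_eq_integral_sharePayoff, ← integral_exp_gaussian, ← integral_const_mul]
  refine integral_mono (integrable_sharePayoff κ v) ((integrable_exp_gaussian _).const_mul _)
    fun z => ?_
  rw [sharePayoff_eq hv]
  set d := κ / v - v / 2
  have h1 := Real.add_one_le_exp (-(v * (z - d)))
  have h2 := Real.add_one_le_exp (d * (z - d))
  have h3 : v * (z - d) ≤ v / d * Real.exp (d * (z - d)) := by
    have : v * (z - d) = v / d * (d * (z - d)) := by field_simp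
    rw [this]
    gcongr
    linarith
  exact max_le (by linarith) (by positivity)

theorem exp_le_gaussianReal_Ici {x : ℝ} (hx : 0 ≤ x) :
    (√(2 * Real.pi))⁻¹ * Real.exp (-(x + 1) ^ 2 / 2) ≤ (gaussianReal 0 1).real (Set.Ici x) := by
  have h1 : (√(2 * Real.pi))⁻¹ * Real.exp (-(x + 1) ^ 2 / 2)
      ≤ (gaussianReal 0 1).real (Set.Icc x (x + 1)) := by
    rw [measureReal_def, gaussianReal_apply_eq_integral _ one_ne_zero, ENNReal.toReal_ofReal
      (integral_nonneg fun _ => gaussianPDFReal_nonneg _ _ _)]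
    refine le_trans (le_of_eq ?_) (setIntegral_ge_of_const_le_real measurableSet_Icc (by simp)
      (c := (√(2 * Real.pi))⁻¹ * Real.exp (-(x + 1) ^ 2 / 2)) (fun z hz => ?_)
      (integrable_gaussianPDFReal 0 1).integrableOn)
    · simp
    · simp only [gaussianPDFReal_def, NNReal.coe_one, mul_one, sub_zero]
      gcongr
      · linarith [hz.1]
      · exact hz.2
  exact h1.trans (measureReal_mono (fun z hz => hz.1))

theorem mul_gaussianReal_Ici_le_blackScholesCall {κ v : ℝ} (hv : 0 < v) :
    (1 - Real.exp (-v)) * (gaussianReal 0 1).real (Set.Ici (κ / v - v / 2 + 1))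
      ≤ blackScholesCall κ v := by
  rw [blackScholesCall_eq_integral_sharePayoff]
  calc _ ≤ ∫ z in Set.Ici (κ / v - v / 2 + 1), sharePayoff κ v z ∂(gaussianReal 0 1) := by
        refine setIntegral_ge_of_const_le_real measurableSet_Ici (measure_ne_top _ _)
          (fun z hz => ?_) (integrable_sharePayoff κ v).integrableOn
        rw [sharePayoff_eq hv]
        refine le_max_of_le_left (sub_le_sub_left (Real.exp_le_exp.2 (neg_le_neg ?_)) _)
        have : κ / v - v / 2 + 1 ≤ z := hz
        nlinarith
    _ ≤ _ := setIntegral_le_integral (integrable_sharePayoff κ v)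
        (ae_of_all _ (sharePayoff_nonneg κ v))

theorem mul_exp_le_blackScholesCall {κ v m : ℝ} (hv : 0 < v) (hm : 0 < m) (hm1 : m ≤ 1)
    (hmκ : m ≤ κ) :
    m * Real.exp (-(max (κ / v - v / 2) 0 + 3) ^ 2 / 2) ≤ blackScholesCall κ v := by
  refine le_trans ?_ (mul_gaussianReal_Ici_le_blackScholesCall hv)
  set d := κ / v - v / 2 with hd
  set D := max d 0
  have hD : 0 ≤ D := le_max_right _ _
  have hdD : d ≤ D := le_max_left _ _
  have h1 : (√(2 * Real.pi))⁻¹ * Real.exp (-(D + 1 + 1) ^ 2 / 2)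
      ≤ (gaussianReal 0 1).real (Set.Ici (d + 1)) :=
    (exp_le_gaussianReal_Ici (by linarith)).trans
      (measureReal_mono (Set.Ici_subset_Ici.2 (by linarith)))
  -- From `κ = v (d + v/2)`: if `v ≤ 2` then `m ≤ κ ≤ v (D + 1)`; if `v ≥ 2` then `v (D + 1) ≥ 2 >
  -- m`.
  have hw : m / (D + 1) ≤ v := by
    rw [div_le_iff₀ (by linarith)]
    have h2 : κ = v * (d + v / 2) := by rw [hd]; field_simp; ring
    rcases le_total v 2 with h | h
    · nlinarith
    · nlinarith
  have hw1 : m / (D + 1) ≤ 1 := by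
    rw [div_le_iff₀ (by linarith)]; linarith
  have hw0 : 0 < m / (D + 1) := by positivity
  have h3 : m / (D + 1) / 2 ≤ 1 - Real.exp (-v) := by
    set w := m / (D + 1)
    have h4 : Real.exp (-v) ≤ Real.exp (-w) := Real.exp_le_exp.2 (by linarith)
    have h5 : Real.exp (-w) * (1 + w) ≤ 1 := by
      have := mul_le_mul_of_nonneg_left (Real.add_one_le_exp w) (Real.exp_pos (-w)).le
      rw [← Real.exp_add] at this
      simp at this
      linarith
    nlinarith
  -- The remaining prefactors are at least `e^{-1}` and `e^{-D-1}`; moving from `(D+2)²/2` to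
  -- `(D+3)²/2` gains `D + 5/2`, which pays for both.
  have h6 : √(2 * Real.pi) ≤ Real.exp 1 := by
    rw [Real.sqrt_le_left (Real.exp_pos 1).le]
    nlinarith [Real.pi_lt_d2, Real.exp_one_gt_d9]
  have h7 : Real.exp (-(1 : ℝ)) ≤ (√(2 * Real.pi))⁻¹ := by
    rw [Real.exp_neg]
    exact inv_anti₀ (by positivity) h6
  have h8 : Real.exp (-D - 1) ≤ 1 / (D + 1) / 2 := by
    rw [div_div, show -D - 1 = -(D + 1) by ring, Real.exp_neg, inv_eq_one_div]
    apply one_div_le_one_div_of_le (by linarith)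
    rw [Real.exp_add]
    have := Real.add_one_le_exp D
    have := Real.exp_one_gt_d9
    apply mul_le_mul <;> linarith
  calc m * Real.exp (-(D + 3) ^ 2 / 2)
      ≤ m * (Real.exp (-D - 1) * (Real.exp (-(1 : ℝ)) * Real.exp (-(D + 1 + 1) ^ 2 / 2))) := by
        rw [← Real.exp_add, ← Real.exp_add]
        gcongr
        linarith
    _ ≤ m * (1 / (D + 1) / 2 * ((√(2 * Real.pi))⁻¹ * Real.exp (-(D + 1 + 1) ^ 2 / 2))) := by
        gcongr
    _ = m / (D + 1) / 2 * ((√(2 * Real.pi))⁻¹ * Real.exp (-(D + 1 + 1) ^ 2 / 2)) := by ring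
    _ ≤ _ := mul_le_mul h3 h1 (by positivity) (le_trans (by positivity) h3)

/-! ### Inverting the Black-Scholes formula asymptotically -/

section Asymptotics

variable {ι : Type*} {l : Filter ι}

/-- Two-sided bounds with arbitrarily small relative error and bounded absolute error. -/
theorem tendsto_div_one_of_bounds {f b : ι → ℝ} (hb : Tendsto b l atTop)
    (hlow : ∀ ε : ℝ, 0 < ε → ε < 1 → ∃ K : ℝ, ∀ᶠ i in l, (1 - ε) * b i - K ≤ f i)
    (hup : ∀ ε : ℝ, 0 < ε → ε < 1 → ∃ K : ℝ, ∀ᶠ i in l, f i ≤ (1 + ε) * b i + K) :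
    Tendsto (fun i => f i / b i) l (𝓝 1) := by
  rw [Metric.tendsto_nhds]
  intro ε hε
  -- One third of `ε` covers the relative error, another third the constant `K`, negligible against
  -- `b`.
  set e := min (ε / 3) (1 / 2) with he
  have he0 : 0 < e := by positivity
  have he1 : e < 1 := (min_le_right _ _).trans_lt (by norm_num)
  have he3 : e ≤ ε / 3 := min_le_left _ _
  obtain ⟨K₁, h₁⟩ := hlow e he0 he1
  obtain ⟨K₂, h₂⟩ := hup e he0 he1
  filter_upwards [h₁, h₂, hb.eventually_gt_atTop 0, hb.eventually_ge_atTop (K₁ / (ε / 3)),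
    hb.eventually_ge_atTop (K₂ / (ε / 3))] with i h₁ h₂ hb hK₁ hK₂
  rw [div_le_iff₀ (by positivity)] at hK₁ hK₂
  have h₃ : f i / b i - 1 = (f i - b i) / b i := by field_simp
  rw [Real.dist_eq, h₃, abs_div, abs_of_pos hb, div_lt_iff₀ hb, abs_lt]
  constructor <;> nlinarith

/-- If `L` lies between `d² / 2` and `(d + K)² / 2` and is large, then `d ∼ √(2 L)`. -/
theorem tendsto_div_sqrt_of_sq_bounds {L d : ι → ℝ} {K : ℝ} (hK : 0 ≤ K) (hL : Tendsto L l atTop)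
    (h₁ : ∀ᶠ i in l, L i ≤ (max (d i) 0 + K) ^ 2 / 2)
    (h₂ : ∀ᶠ i in l, 1 ≤ d i → d i ^ 2 / 2 ≤ L i) :
    Tendsto d l atTop ∧ Tendsto (fun i => d i / √(2 * L i)) l (𝓝 1) := by
  have hs : Tendsto (fun i => √(2 * L i)) l atTop :=
    Real.tendsto_sqrt_atTop.comp (hL.const_mul_atTop two_pos)
  have h₃ : ∀ᶠ i in l, √(2 * L i) ≤ max (d i) 0 + K := by
    filter_upwards [h₁] with i h₁
    rw [Real.sqrt_le_left (by positivity)]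
    linarith
  have h₄ : ∀ᶠ i in l, √(2 * L i) - K ≤ d i := by
    filter_upwards [h₃, hs.eventually_gt_atTop K] with i h₃ h
    rcases le_total (d i) 0 with hd | hd
    · rw [max_eq_right hd] at h₃; linarith
    · rw [max_eq_left hd] at h₃; linarith
  have hd : Tendsto d l atTop :=
    tendsto_atTop_mono' l h₄ (tendsto_atTop_add_const_right l (-K) hs)
  refine ⟨hd, ?_⟩
  refine tendsto_div_one_of_bounds hs (fun ε hε _ => ⟨K, ?_⟩) (fun ε hε _ => ⟨0, ?_⟩)
  · filter_upwards [h₄, hs.eventually_gt_atTop 0] with i h h0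
    nlinarith
  · filter_upwards [h₂, hd.eventually_ge_atTop 1, hs.eventually_gt_atTop 0] with i h h1 h0
    have : d i ≤ √(2 * L i) := Real.le_sqrt_of_sq_le (by linarith [h h1])
    nlinarith

theorem tendsto_div_sqrt_neg_log_blackScholesCall {κ v : ι → ℝ} {δ : ℝ} (hδ : 0 < δ)
    (hκ : ∀ᶠ i in l, δ ≤ κ i) (hv : ∀ i, 0 < v i)
    (hc : ∀ i, 0 < blackScholesCall (κ i) (v i))
    (hL : Tendsto (fun i => -Real.log (blackScholesCall (κ i) (v i))) l atTop) :
    Tendsto (fun i => κ i / v i - v i / 2) l atTop ∧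
      Tendsto (fun i => (κ i / v i - v i / 2) /
        √(2 * -Real.log (blackScholesCall (κ i) (v i)))) l (𝓝 1) := by
  set m := min δ 1 with hm
  have hm0 : 0 < m := by positivity
  have hm1 : m ≤ 1 := min_le_right _ _
  have hlm : Real.log m ≤ 0 := Real.log_nonpos hm0.le hm1
  -- The prefactor `m` goes into the square: `x²/2 + y ≤ (x + y)²/2` for `x ≥ 1`, `y ≥ 0`, here with
  -- `y = -log m`.
  refine tendsto_div_sqrt_of_sq_bounds (K := 3 - Real.log m) (by linarith) hL ?_ ?_
  · filter_upwards [hκ] with i hκ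
    have h := mul_exp_le_blackScholesCall (hv i) hm0 hm1 ((min_le_left _ _).trans hκ)
    have h' := Real.log_le_log (by positivity) h
    rw [Real.log_mul hm0.ne' (Real.exp_pos _).ne', Real.log_exp] at h'
    have h0 : 0 ≤ max (κ i / v i - v i / 2) 0 := le_max_right _ _
    nlinarith
  · refine Eventually.of_forall fun i hd => ?_
    have h := blackScholesCall_le_exp (κ := κ i) (hv i) (by linarith)
    have h' := Real.log_le_log (hc i) h
    rw [Real.log_exp] at h'
    linarith

theorem tendsto_div_sqrt_neg_log_blackScholesCall_div {κ v : ι → ℝ} (hκ0 : ∀ i, 0 < κ i)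
    (hκ : Tendsto κ l (𝓝 0)) (hv : ∀ i, 0 < v i)
    (hc : ∀ i, 0 < blackScholesCall (κ i) (v i))
    (hL : Tendsto (fun i => -Real.log (blackScholesCall (κ i) (v i) / κ i)) l atTop) :
    Tendsto (fun i => κ i / v i - v i / 2) l atTop ∧
      Tendsto (fun i => (κ i / v i - v i / 2) /
        √(2 * -Real.log (blackScholesCall (κ i) (v i) / κ i))) l (𝓝 1) := by
  refine tendsto_div_sqrt_of_sq_bounds (K := 3) (by norm_num) hL ?_ ?_
  · filter_upwards [hκ.eventually (gt_mem_nhds zero_lt_one)] with i hκ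
    have h := mul_exp_le_blackScholesCall (hv i) (hκ0 i) hκ.le le_rfl
    rw [mul_comm, ← le_div_iff₀ (hκ0 i)] at h
    have h' := Real.log_le_log (by positivity) h
    rw [Real.log_exp] at h'
    linarith
  · refine Eventually.of_forall fun i hd => ?_
    have hd0 : 0 < κ i / v i - v i / 2 := by linarith
    have h := blackScholesCall_le_div_mul_exp (hv i) hd0
    -- Since `v d ≤ κ`, the condition `d ≥ 1` gives `v ≤ κ`, so the prefactor `v/d` is at most `κ`.
    have h1 : v i / (κ i / v i - v i / 2) ≤ κ i := by
      rw [div_le_iff₀ hd0]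
      have h2 : v i * (κ i / v i) = κ i := by have := (hv i).ne'; field_simp
      have h3 : v i ≤ κ i := by nlinarith [hv i]
      nlinarith [hκ0 i]
    have h4 : blackScholesCall (κ i) (v i) / κ i ≤ Real.exp (-(κ i / v i - v i / 2) ^ 2 / 2) := by
      rw [div_le_iff₀ (hκ0 i), mul_comm]
      exact h.trans (by gcongr)
    have h' := Real.log_le_log (div_pos (hc i) (hκ0 i)) h4
    rw [Real.log_exp] at h'
    linarith

theorem sqrt_sq_add_add_eq {κ v : ℝ} (hκ : 0 < κ) (hv : 0 < v) :
    √((κ / v - v / 2) ^ 2 + 2 * κ) + (κ / v - v / 2) = 2 * κ / v := by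
  have : (κ / v - v / 2) ^ 2 + 2 * κ = (κ / v + v / 2) ^ 2 := by field_simp; ring
  rw [this, Real.sqrt_sq (by positivity)]
  ring

/-- The map `x ↦ √(x² + 2κ) + x` preserves asymptotic equivalence, uniformly in `κ`. -/
theorem tendsto_sqrt_sq_add_add_div {κ d b : ι → ℝ} (hκ : ∀ i, 0 < κ i)
    (hd : ∀ᶠ i in l, 0 < d i) (hb : ∀ᶠ i in l, 0 < b i)
    (h : Tendsto (fun i => b i / d i) l (𝓝 1)) :
    Tendsto (fun i => (√(b i ^ 2 + 2 * κ i) + b i) / (√(d i ^ 2 + 2 * κ i) + d i)) l (𝓝 1) := by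
  have hmin : Tendsto (fun i => min 1 (b i / d i)) l (𝓝 1) := by
    simpa using (tendsto_const_nhds (x := (1 : ℝ))).min h
  have hmax : Tendsto (fun i => max 1 (b i / d i)) l (𝓝 1) := by
    simpa using (tendsto_const_nhds (x := (1 : ℝ))).max h
  refine tendsto_of_tendsto_of_tendsto_of_le_of_le' hmin hmax ?_ ?_
  · filter_upwards [hd, hb] with i hd hb
    set r := min 1 (b i / d i) with hr
    have hr0 : 0 < r := by positivity
    have hr1 : r ≤ 1 := min_le_left _ _
    have hrb : r * d i ≤ b i := (le_div_iff₀ hd).1 (min_le_right _ _)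
    rw [le_div_iff₀ (by positivity), mul_add]
    refine add_le_add ?_ hrb
    -- For `r ≤ 1` the term `2κ` only shrinks under multiplication by `r²`; hence no condition on
    -- the size of `κ`.
    apply Real.le_sqrt_of_sq_le
    rw [mul_pow, Real.sq_sqrt (by have := hκ i; positivity), mul_add, ← mul_pow]
    have h1 : (r * d i) ^ 2 ≤ b i ^ 2 := by gcongr
    have h2 : r ^ 2 ≤ 1 := by nlinarith
    nlinarith [hκ i]
  · filter_upwards [hd, hb] with i hd hb
    set r := max 1 (b i / d i) with hr
    have hr1 : 1 ≤ r := le_max_left _ _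
    have hrb : b i ≤ r * d i := (div_le_iff₀ hd).1 (le_max_right _ _)
    rw [div_le_iff₀ (by positivity), mul_add]
    refine add_le_add ?_ hrb
    rw [Real.sqrt_le_left (by positivity), mul_pow,
      Real.sq_sqrt (by have := hκ i; positivity), mul_add, ← mul_pow]
    have h1 : b i ^ 2 ≤ (r * d i) ^ 2 := by gcongr
    have h2 : 1 ≤ r ^ 2 := by nlinarith
    nlinarith [hκ i]

/-- `v ∼ 2κ / (√(b² + 2κ) + b)` if `κ / v - v / 2 ∼ b`. -/
theorem tendsto_div_of_tendsto_div_sqrt {κ v L b : ι → ℝ} (hκ : ∀ i, 0 < κ i)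
    (hv : ∀ i, 0 < v i) (hL : Tendsto L l atTop) (hb : ∀ᶠ i in l, 0 < b i)
    (hd : Tendsto (fun i => κ i / v i - v i / 2) l atTop)
    (hdL : Tendsto (fun i => (κ i / v i - v i / 2) / √(2 * L i)) l (𝓝 1))
    (hLb : Tendsto (fun i => L i / b i) l (𝓝 1)) :
    Tendsto (fun i => v i / (2 * κ i / (√(2 * b i + 2 * κ i) + √(2 * b i)))) l (𝓝 1) := by
  have h1 : Tendsto (fun i => √(2 * b i) / (κ i / v i - v i / 2)) l (𝓝 1) := by
    have h := (hdL.mul (hLb.sqrt)).inv₀ (by simp)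
    simp only [Real.sqrt_one, mul_one, inv_one] at h
    refine h.congr' ?_
    filter_upwards [hb, hL.eventually_gt_atTop 0, hd.eventually_gt_atTop 0] with i hb hL hd
    have e : √(L i / b i) = √(2 * L i) / √(2 * b i) := by
      rw [← Real.sqrt_div' _ (by positivity)]; congr 1; field_simp
    have : 0 < √(2 * L i) := by positivity
    have : 0 < √(2 * b i) := by positivity
    rw [e]
    field_simp
  have h2 := tendsto_sqrt_sq_add_add_div hκ (hd.eventually_gt_atTop 0)
    (hb.mono fun i hi => Real.sqrt_pos.2 (by linarith)) h1
  refine h2.congr' ?_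
  filter_upwards [hb] with i hb
  rw [sqrt_sq_add_add_eq (hκ i) (hv i), Real.sq_sqrt (by positivity)]
  have := hκ i
  have := hv i
  field_simp

/-- `v ∼ κ / √(2 L)` if `κ / v - v / 2 ∼ √(2 L)` and `κ = o(L)`. -/
theorem tendsto_div_simple_of_tendsto_div_sqrt {κ v L a : ι → ℝ} (hκ : ∀ i, 0 < κ i)
    (hv : ∀ i, 0 < v i) (hL : Tendsto L l atTop)
    (ha : Tendsto a l atTop)
    (hd : Tendsto (fun i => κ i / v i - v i / 2) l atTop)
    (hdL : Tendsto (fun i => (κ i / v i - v i / 2) / √(2 * L i)) l (𝓝 1))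
    (hLa : Tendsto (fun i => L i / a i) l (𝓝 1))
    (hκa : Tendsto (fun i => κ i / a i) l (𝓝 0)) :
    Tendsto (fun i => v i / (κ i / √(2 * a i))) l (𝓝 1) := by
  have hda : Tendsto (fun i => (κ i / v i - v i / 2) / √(2 * a i)) l (𝓝 1) := by
    have h := hdL.mul (hLa.sqrt)
    simp only [Real.sqrt_one, mul_one] at h
    refine h.congr' ?_
    filter_upwards [ha.eventually_gt_atTop 0, hL.eventually_gt_atTop 0] with i ha hL
    have e : √(L i / a i) = √(2 * L i) / √(2 * a i) := by
      rw [← Real.sqrt_div' _ (by positivity)]; congr 1; field_simp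
    have : 0 < √(2 * L i) := by positivity
    rw [e]
    field_simp
  have hκd : Tendsto (fun i => κ i / (κ i / v i - v i / 2) ^ 2) l (𝓝 0) := by
    have h := (hκa.div_const 2).div (hda.pow 2) (by simp)
    simp only [zero_div] at h
    refine h.congr' ?_
    filter_upwards [ha.eventually_gt_atTop 0, hd.eventually_gt_atTop 0] with i ha hd
    simp only [Pi.div_apply]
    rw [div_pow, Real.sq_sqrt (by positivity)]
    field_simp
  -- As `v d ≤ κ`, one has `v/d ≤ κ/d² → 0`. Thus `v/2` is negligible in `κ/v = d + v/2`.
  have hvd : Tendsto (fun i => v i / (κ i / v i - v i / 2)) l (𝓝 0) := by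
    refine squeeze_zero' ?_ ?_ hκd
    · filter_upwards [hd.eventually_gt_atTop 0] with i hd
      exact div_nonneg (hv i).le hd.le
    · filter_upwards [hd.eventually_gt_atTop 0] with i hd
      rw [div_le_div_iff₀ hd (by positivity)]
      have h2 : v i * (κ i / v i) = κ i := by have := (hv i).ne'; field_simp
      have h3 : v i * (κ i / v i - v i / 2) ≤ κ i := by nlinarith [hv i]
      nlinarith
  have h1 : Tendsto (fun i => (κ i / v i) / (κ i / v i - v i / 2)) l (𝓝 1) := by
    have h := (hvd.div_const 2).const_add 1
    simp only [zero_div, add_zero] at h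
    refine h.congr' ?_
    filter_upwards [hd.eventually_gt_atTop 0] with i hd
    rw [eq_div_iff hd.ne', add_mul, one_mul, div_right_comm, div_mul_cancel₀ _ hd.ne']
    ring
  have h := (h1.mul hda).inv₀ (by simp)
  simp only [mul_one, inv_one] at h
  refine h.congr' ?_
  filter_upwards [ha.eventually_gt_atTop 0, hd.eventually_gt_atTop 0] with i ha hd
  have := hκ i
  have := hv i
  rw [div_mul_div_cancel₀ hd.ne']
  field_simp

end Asymptotics

/-! ### Extended logarithms and Hölder's inequality -/

theorem toReal_le_exp_of_lt_log_div {x : ℝ≥0∞} (hx : x ≠ ⊤) {a r : ℝ} (ha : 0 < a)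
    (h : (r : EReal) < ENNReal.log x / ((-a : ℝ) : EReal)) : x.toReal ≤ Real.exp (-(r * a)) := by
  rcases eq_or_ne x 0 with rfl | h0
  · simpa using (Real.exp_pos _).le
  have hpos := ENNReal.toReal_pos h0 hx
  rw [ENNReal.log_pos_real h0 hx, ← EReal.coe_div, EReal.coe_lt_coe_iff, div_neg,
    lt_neg, div_lt_iff₀ ha] at h
  rw [← Real.log_le_iff_le_exp hpos]
  linarith

theorem exp_le_toReal_of_log_div_lt {x : ℝ≥0∞} (hx : x ≠ ⊤) {a r : ℝ} (ha : 0 < a)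
    (h : ENNReal.log x / ((-a : ℝ) : EReal) < (r : EReal)) : Real.exp (-(r * a)) ≤ x.toReal := by
  rcases eq_or_ne x 0 with rfl | h0
  · exfalso
    rw [ENNReal.log_zero, EReal.bot_div_of_neg_ne_bot (by exact_mod_cast neg_neg_of_pos ha)
      (EReal.coe_ne_bot _)] at h
    exact not_top_lt h
  have hpos := ENNReal.toReal_pos h0 hx
  rw [ENNReal.log_pos_real h0 hx, ← EReal.coe_div, EReal.coe_lt_coe_iff, div_neg,
    neg_lt, lt_div_iff₀ ha] at h
  rw [← Real.le_log_iff_exp_le hpos]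
  linarith

/-- Hölder's inequality on an event, with a bound on the moment of order `1 + η`. -/
theorem setLIntegral_ofReal_le_of_moment_le {Ω : Type*} [MeasurableSpace Ω] {P : Measure Ω}
    {Y : Ω → ℝ} (hY : Measurable Y) {η : ℝ} (hη : 0 < η) {M : ℝ≥0∞}
    (hM : ∫⁻ ω, ENNReal.ofReal (|Y ω| ^ (1 + η)) ∂P ≤ M) (A : Set Ω) :
    ∫⁻ ω in A, ENNReal.ofReal (Y ω) ∂P ≤ M ^ (1 / (1 + η)) * P A ^ (η / (1 + η)) := by
  have hpq : (1 + η).HolderConjugate ((1 + η) / η) := by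
    rw [Real.holderConjugate_iff]
    exact ⟨by linarith, by field_simp⟩
  have h := ENNReal.lintegral_mul_le_Lp_mul_Lq (P.restrict A) hpq
    (f := fun ω => ENNReal.ofReal |Y ω|) (g := fun _ => 1) (by fun_prop) (by fun_prop)
  simp only [Pi.mul_apply, mul_one, ENNReal.one_rpow, lintegral_one, Measure.restrict_apply_univ,
    one_div_div] at h
  calc _ ≤ ∫⁻ ω in A, ENNReal.ofReal |Y ω| ∂P :=
        lintegral_mono fun ω => ENNReal.ofReal_le_ofReal (le_abs_self _)
    _ ≤ _ := h
    _ ≤ _ := by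
        gcongr
        refine le_trans (setLIntegral_le_lintegral _ _) (le_trans (le_of_eq ?_) hM)
        refine lintegral_congr fun ω => ?_
        rw [ENNReal.ofReal_rpow_of_nonneg (abs_nonneg _) (by linarith)]

/-! ### Call prices in the model and existence of the implied volatility -/

section Model

variable {Ω : Type*} {mΩ : MeasurableSpace Ω} {P : Measure Ω}
  {ℱ : Filtration ℝ≥0 mΩ} {X : ℝ≥0 → Ω → ℝ}

theorem IsRiskNeutralLogPrice.measurable (hX : IsRiskNeutralLogPrice P ℱ X) (t : ℝ≥0) :
    Measurable (X t) := by
  have h := ((hX.martingale.1 t).mono (ℱ.le t)).measurable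
  simpa [Function.comp_def] using Real.measurable_log.comp h

theorem IsRiskNeutralLogPrice.integrable_exp (hX : IsRiskNeutralLogPrice P ℱ X) (t : ℝ≥0) :
    Integrable (fun ω => Real.exp (X t ω)) P := hX.martingale.integrable t

theorem measurableSet_lt_logPrice (hX : IsRiskNeutralLogPrice P ℱ X) (t : ℝ≥0) (x : ℝ) :
    MeasurableSet {ω | x < X t ω} := measurableSet_lt measurable_const (hX.measurable t)

theorem IsRiskNeutralLogPrice.integral_exp [IsProbabilityMeasure P]
    (hX : IsRiskNeutralLogPrice P ℱ X) (t : ℝ≥0) : ∫ ω, Real.exp (X t ω) ∂P = 1 := by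
  have h := hX.martingale.setIntegral_eq (zero_le (a := t)) MeasurableSet.univ
  simp only [setIntegral_univ] at h
  rw [← h]
  have h0 : (fun ω => Real.exp (X 0 ω)) =ᵐ[P] fun _ => 1 := by
    filter_upwards [hX.init] with ω h
    simp [h]
  simp [integral_congr_ae h0]

theorem callPayoff_nonneg (x κ : ℝ) : 0 ≤ max (Real.exp x - Real.exp κ) 0 := le_max_right _ _

theorem callPayoff_lt (x κ : ℝ) : max (Real.exp x - Real.exp κ) 0 < Real.exp x :=
  max_lt (by linarith [Real.exp_pos κ]) (Real.exp_pos x)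

theorem integrable_callPayoff (hX : IsRiskNeutralLogPrice P ℱ X) (κ : ℝ) (t : ℝ≥0) :
    Integrable (fun ω => max (Real.exp (X t ω) - Real.exp κ) 0) P := by
  have := hX.measurable t
  refine (hX.integrable_exp t).mono (by fun_prop) (ae_of_all _ fun ω => ?_)
  rw [Real.norm_of_nonneg (callPayoff_nonneg _ _), Real.norm_of_nonneg (Real.exp_pos _).le]
  exact (callPayoff_lt _ _).le

/-- Strictness matters: the Black-Scholes price tends to `1` but does not attain it. It holds
because the payoff is everywhere below `e^{X_t}`, of mean `1`. -/
theorem callPrice_lt_one [IsProbabilityMeasure P] (hX : IsRiskNeutralLogPrice P ℱ X)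
    (κ : ℝ) (t : ℝ≥0) : callPrice P X κ t < 1 := by
  rw [← hX.integral_exp t, callPrice, ← sub_pos,
    ← integral_sub (hX.integrable_exp t) (integrable_callPayoff hX κ t),
    integral_pos_iff_support_of_nonneg (fun ω => (sub_pos.2 (callPayoff_lt _ _)).le)
      ((hX.integrable_exp t).sub (integrable_callPayoff hX κ t))]
  have : Function.support (fun ω => Real.exp (X t ω) - max (Real.exp (X t ω) - Real.exp κ) 0)
      = Set.univ := Set.eq_univ_of_forall fun ω => (sub_pos.2 (callPayoff_lt _ _)).ne'
  rw [this]
  simp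

theorem existsUnique_isImpliedVolatility [IsProbabilityMeasure P]
    (hX : IsRiskNeutralLogPrice P ℱ X) {κ : ℝ} {t : ℝ≥0} (hκ : 0 < κ) (ht : 0 < t)
    (hc : 0 < callPrice P X κ t) : ∃! σ : ℝ, IsImpliedVolatility P X κ t σ := by
  obtain ⟨v, ⟨hv, hvc⟩, huniq⟩ := existsUnique_blackScholesCall_eq hκ hc (callPrice_lt_one hX κ t)
  have hs : 0 < √(t : ℝ) := Real.sqrt_pos.2 (by exact_mod_cast ht)
  refine ⟨v / √(t : ℝ), ⟨by positivity, by rw [div_mul_cancel₀ _ hs.ne', hvc]⟩, fun σ hσ => ?_⟩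
  rw [eq_div_iff hs.ne']
  exact huniq _ ⟨mul_nonneg hσ.1 hs.le, hσ.2⟩

theorem isImpliedVolatility_impliedVolatility [IsProbabilityMeasure P]
    (hX : IsRiskNeutralLogPrice P ℱ X) {κ : ℝ} {t : ℝ≥0} (hκ : 0 < κ) (ht : 0 < t)
    (hc : 0 < callPrice P X κ t) :
    IsImpliedVolatility P X κ t (impliedVolatility P X κ t) := by
  obtain ⟨σ, hσ, huniq⟩ := existsUnique_isImpliedVolatility hX hκ ht hc
  have : {σ : ℝ | IsImpliedVolatility P X κ t σ} = {σ} :=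
    Set.eq_singleton_iff_unique_mem.2 ⟨hσ, huniq⟩
  rw [impliedVolatility, this, csInf_singleton]
  exact hσ

theorem ofReal_callPrice_le (hX : IsRiskNeutralLogPrice P ℱ X) {κ : ℝ} {t : ℝ≥0}
    {Y : Ω → ℝ} (hY : ∀ ω, κ < X t ω → Real.exp (X t ω) - Real.exp κ ≤ Y ω) :
    ENNReal.ofReal (callPrice P X κ t) ≤ ∫⁻ ω in {ω | κ < X t ω}, ENNReal.ofReal (Y ω) ∂P := by
  rw [callPrice, ofReal_integral_eq_lintegral_ofReal (integrable_callPayoff hX κ t)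
    (ae_of_all _ fun ω => callPayoff_nonneg _ _),
    ← lintegral_indicator (measurableSet_lt_logPrice hX t κ)]
  refine lintegral_mono fun ω => ?_
  by_cases h : κ < X t ω
  · rw [Set.indicator_of_mem (show ω ∈ {ω | κ < X t ω} from h),
      max_eq_left (sub_nonneg.2 (Real.exp_le_exp.2 h.le))]
    exact ENNReal.ofReal_le_ofReal (hY ω h)
  · rw [max_eq_right (sub_nonpos.2 (Real.exp_le_exp.2 (not_lt.1 h)))]
    simp

theorem mul_rightTail_le_callPrice [IsProbabilityMeasure P] (hX : IsRiskNeutralLogPrice P ℱ X)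
    (κ y : ℝ) (t : ℝ≥0) :
    (Real.exp y - Real.exp κ) * (rightTail P X y t).toReal ≤ callPrice P X κ t := by
  calc _ ≤ ∫ ω in {ω | y < X t ω}, max (Real.exp (X t ω) - Real.exp κ) 0 ∂P := by
        refine setIntegral_ge_of_const_le_real (measurableSet_lt_logPrice hX t y)
          (measure_ne_top _ _) (fun ω hω => le_max_of_le_left ?_)
          (integrable_callPayoff hX κ t).integrableOn
        exact sub_le_sub_right (Real.exp_le_exp.2 (le_of_lt hω)) _
    _ ≤ _ := setIntegral_le_integral (integrable_callPayoff hX κ t)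
        (ae_of_all _ fun ω => callPayoff_nonneg _ _)

theorem rightTail_ne_top [IsProbabilityMeasure P] (κ : ℝ) (t : ℝ≥0) : rightTail P X κ t ≠ ⊤ :=
  measure_ne_top _ _

/-- A positive price makes `logTail` a genuine logarithm, free of the default value at `0`. -/
theorem rightTail_toReal_pos [IsProbabilityMeasure P] (hX : IsRiskNeutralLogPrice P ℱ X)
    {κ : ℝ} {t : ℝ≥0} (hc : 0 < callPrice P X κ t) : 0 < (rightTail P X κ t).toReal := by
  refine ENNReal.toReal_pos (fun h => ?_) (rightTail_ne_top κ t)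
  have h1 := ofReal_callPrice_le hX (κ := κ) (t := t)
    (Y := fun ω => Real.exp (X t ω) - Real.exp κ) (fun _ _ => le_rfl)
  rw [setLIntegral_measure_zero _ _ h] at h1
  have := ENNReal.ofReal_pos.2 hc
  exact absurd h1 (not_le.2 this)

/-! ### Regular tail decay and the lower bound on the price -/

variable {ι : Type*} {l : Filter ι} {κ : ι → ℝ} {τ : ι → ℝ≥0} {I : ℝ → ℝ≥0∞}

theorem exp_logTail [IsProbabilityMeasure P] (hX : IsRiskNeutralLogPrice P ℱ X)
    {κ : ℝ} {t : ℝ≥0} (hc : 0 < callPrice P X κ t) :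
    Real.exp (logTail P X κ t) = (rightTail P X κ t).toReal :=
  Real.exp_log (rightTail_toReal_pos hX hc)

theorem log_rightTail [IsProbabilityMeasure P] (hX : IsRiskNeutralLogPrice P ℱ X)
    {κ : ℝ} {t : ℝ≥0} (hc : 0 < callPrice P X κ t) :
    ENNReal.log (rightTail P X κ t) = (logTail P X κ t : EReal) :=
  ENNReal.log_pos_real' (rightTail_toReal_pos hX hc)

theorem tendsto_neg_logTail [IsProbabilityMeasure P] (hX : IsRiskNeutralLogPrice P ℱ X)
    (hc : ∀ i, 0 < callPrice P X (κ i) (τ i)) (hI : RegularRightDecay P X l κ τ I) :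
    Tendsto (fun i => -logTail P X (κ i) (τ i)) l atTop := by
  refine tendsto_neg_atBot_atTop.comp (Real.tendsto_log_nhdsGT_zero.comp ?_)
  refine tendsto_nhdsWithin_iff.2 ⟨?_, Eventually.of_forall fun i => rightTail_toReal_pos hX (hc i)⟩
  exact (ENNReal.tendsto_toReal ENNReal.zero_ne_top).comp hI.tail_tendsto

/-- This and its converse turn the limits `I ρ` into real power bounds, comparing `P(X_t > ρκ)` with
`P(X_t > κ)^r`. -/
theorem eventually_rightTail_le [IsProbabilityMeasure P] (hX : IsRiskNeutralLogPrice P ℱ X)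
    (hc : ∀ i, 0 < callPrice P X (κ i) (τ i)) (hI : RegularRightDecay P X l κ τ I)
    {ρ r : ℝ} (hρ : 1 ≤ ρ) (hr0 : 0 ≤ r) (hr : ENNReal.ofReal r < I ρ) :
    ∀ᶠ i in l, (rightTail P X (ρ * κ i) (τ i)).toReal
      ≤ Real.exp (-(r * -logTail P X (κ i) (τ i))) := by
  have h : (r : EReal) < (I ρ : EReal) := by
    rw [← EReal.coe_ennreal_lt_coe_ennreal_iff, EReal.coe_ennreal_ofReal, max_eq_left hr0] at hr
    exact hr
  filter_upwards [(hI.ratio_tendsto ρ hρ).eventually (lt_mem_nhds h),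
    (tendsto_neg_logTail hX hc hI).eventually_gt_atTop 0] with i hi ha
  refine toReal_le_exp_of_lt_log_div (rightTail_ne_top _ _) ha ?_
  rwa [neg_neg, ← log_rightTail hX (hc i)]

theorem eventually_le_rightTail [IsProbabilityMeasure P] (hX : IsRiskNeutralLogPrice P ℱ X)
    (hc : ∀ i, 0 < callPrice P X (κ i) (τ i)) (hI : RegularRightDecay P X l κ τ I)
    {ρ r : ℝ} (hρ : 1 ≤ ρ) (hr0 : 0 ≤ r) (hr : I ρ < ENNReal.ofReal r) :
    ∀ᶠ i in l, Real.exp (-(r * -logTail P X (κ i) (τ i)))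
      ≤ (rightTail P X (ρ * κ i) (τ i)).toReal := by
  have h : (I ρ : EReal) < (r : EReal) := by
    rw [← EReal.coe_ennreal_lt_coe_ennreal_iff, EReal.coe_ennreal_ofReal, max_eq_left hr0] at hr
    exact hr
  filter_upwards [(hI.ratio_tendsto ρ hρ).eventually (gt_mem_nhds h),
    (tendsto_neg_logTail hX hc hI).eventually_gt_atTop 0] with i hi ha
  refine exp_le_toReal_of_log_div_lt (rightTail_ne_top _ _) ha ?_
  rwa [neg_neg, ← log_rightTail hX (hc i)]

theorem exists_lt_ofReal_one_add (hI : RegularRightDecay P X l κ τ I) {ε : ℝ} (hε : 0 < ε) :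
    ∃ ρ : ℝ, 1 < ρ ∧ I ρ < ENNReal.ofReal (1 + ε) := by
  have h : (1 : ℝ≥0∞) < ENNReal.ofReal (1 + ε) := by
    rw [ENNReal.one_lt_ofReal]; linarith
  obtain ⟨ρ, h1, h2⟩ := ((hI.tendsto_one.eventually (gt_mem_nhds h)).and
    self_mem_nhdsWithin).exists
  exact ⟨ρ, h2, h1⟩

/-- Lower bound on the call price: the logarithm of `c / e^κ / κ` is at least
`(1 + ε) log P(X_t > κ)`, up to a constant. -/
theorem exists_mul_exp_le_callPrice [IsProbabilityMeasure P] (hX : IsRiskNeutralLogPrice P ℱ X)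
    (hκ : ∀ i, 0 < κ i)
    (hc : ∀ i, 0 < callPrice P X (κ i) (τ i)) (hI : RegularRightDecay P X l κ τ I)
    {ε : ℝ} (hε : 0 < ε) :
    ∃ k : ℝ, 0 < k ∧ ∀ᶠ i in l,
      k * κ i * Real.exp (κ i - (1 + ε) * -logTail P X (κ i) (τ i))
        ≤ callPrice P X (κ i) (τ i) := by
  obtain ⟨ρ, hρ, hIρ⟩ := exists_lt_ofReal_one_add hI hε
  refine ⟨ρ - 1, by linarith, ?_⟩
  filter_upwards [eventually_le_rightTail hX hc hI hρ.le (by linarith) hIρ] with i hi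
  refine le_trans ?_ (mul_rightTail_le_callPrice hX (κ i) (ρ * κ i) (τ i))
  -- By `e^x - 1 ≥ x` at `x = (ρ - 1)κ`. The factor `κ` is the normalisation needed when `κ → 0`.
  have h1 : (ρ - 1) * κ i * Real.exp (κ i) ≤ Real.exp (ρ * κ i) - Real.exp (κ i) := by
    have e : Real.exp (ρ * κ i) = Real.exp ((ρ - 1) * κ i) * Real.exp (κ i) := by
      rw [← Real.exp_add]; congr 1; ring
    rw [e]
    nlinarith [Real.add_one_le_exp ((ρ - 1) * κ i), Real.exp_pos (κ i)]
  rw [sub_eq_add_neg (κ i), Real.exp_add, ← mul_assoc]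
  exact mul_le_mul h1 hi (Real.exp_pos _).le
    (le_trans (by have := hκ i; have := sub_pos.2 hρ; positivity) h1)

/-! ### Upper bounds on the price from moments -/

/-- Bounded moments of order `1 + η` control the contribution of a tail event. -/
theorem exists_setLIntegral_le_of_limsup_moment {Y : ι → Ω → ℝ} (hY : ∀ i, Measurable (Y i))
    {η : ℝ} (hη : 0 < η)
    (hM : limsup (fun i => ∫⁻ ω, ENNReal.ofReal (|Y i ω| ^ (1 + η)) ∂P) l < ⊤) :
    ∃ K : ℝ, 0 ≤ K ∧ ∀ᶠ i in l, ∀ A : Set Ω, ∀ s : ℝ, P A ≠ ⊤ →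
      (P A).toReal ≤ Real.exp (-s) →
      ∫⁻ ω in A, ENNReal.ofReal (Y i ω) ∂P
        ≤ ENNReal.ofReal (K * Real.exp (-(η / (1 + η) * s))) := by
  obtain ⟨M, hM1, hM2⟩ := exists_between hM
  refine ⟨(M ^ (1 / (1 + η))).toReal, ENNReal.toReal_nonneg, ?_⟩
  filter_upwards [eventually_lt_of_limsup_lt hM1] with i hi A s hA hs
  refine (setLIntegral_ofReal_le_of_moment_le (hY i) hη hi.le A).trans ?_
  rw [ENNReal.ofReal_mul ENNReal.toReal_nonneg, ENNReal.ofReal_toReal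
    (ENNReal.rpow_ne_top_of_nonneg (by positivity) hM2.ne)]
  gcongr
  rw [show -(η / (1 + η) * s) = -s * (η / (1 + η)) by ring, Real.exp_mul,
    ← ENNReal.ofReal_rpow_of_nonneg (Real.exp_pos _).le (by positivity)]
  gcongr
  rw [← ENNReal.ofReal_toReal hA]
  exact ENNReal.ofReal_le_ofReal hs

/-- Upper bound on tail expectations under either all moments, or one moment and a tail which
decays faster than any power of itself. -/
theorem exists_setLIntegral_le_exp [IsProbabilityMeasure P] (hX : IsRiskNeutralLogPrice P ℱ X)
    (hc : ∀ i, 0 < callPrice P X (κ i) (τ i)) (hI : RegularRightDecay P X l κ τ I)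
    {Y : ι → Ω → ℝ} (hY : ∀ i, Measurable (Y i))
    (hmom : (∀ η : ℝ, 0 < η →
        limsup (fun i => ∫⁻ ω, ENNReal.ofReal (|Y i ω| ^ (1 + η)) ∂P) l < ⊤) ∨
      ((∃ η : ℝ, 0 < η ∧
        limsup (fun i => ∫⁻ ω, ENNReal.ofReal (|Y i ω| ^ (1 + η)) ∂P) l < ⊤) ∧
        Tendsto I atTop (𝓝 ⊤)))
    (hmid : ∀ R : ℝ, 1 ≤ R → ∀ ε : ℝ, 0 < ε → ∀ᶠ i in l, ∀ ω, X (τ i) ω ≤ R * κ i →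
      Y i ω ≤ Real.exp (ε * -logTail P X (κ i) (τ i)))
    {ε : ℝ} (hε : 0 < ε) :
    ∃ K : ℝ, 0 < K ∧ ∀ᶠ i in l, ∫⁻ ω in {ω | κ i < X (τ i) ω}, ENNReal.ofReal (Y i ω) ∂P
      ≤ ENNReal.ofReal (K * Real.exp (-((1 - ε) * -logTail P X (κ i) (τ i)))) := by
  have ha := tendsto_neg_logTail hX hc hI
  have htail : ∀ i, (P {ω | κ i < X (τ i) ω}).toReal
      ≤ Real.exp (-(-logTail P X (κ i) (τ i))) := fun i => by
    rw [neg_neg, exp_logTail hX (hc i)]; rfl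
  rcases hmom with hall | ⟨⟨η, hη, hM⟩, hItop⟩
  -- With `η = 1/ε` the Hölder power is `η/(1+η) = 1/(1+ε) ≥ 1 - ε`.
  · have hη : 0 < 1 / ε := by positivity
    obtain ⟨K, hK, h⟩ := exists_setLIntegral_le_of_limsup_moment hY hη (hall _ hη)
    refine ⟨K + 1, by linarith, ?_⟩
    filter_upwards [h, ha.eventually_gt_atTop 0] with i h ha
    refine (h _ _ (measure_ne_top _ _) (htail i)).trans (ENNReal.ofReal_le_ofReal ?_)
    have e : 1 - ε ≤ 1 / ε / (1 + 1 / ε) := by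
      rw [le_div_iff₀ (by positivity), mul_add, mul_one, sub_mul, mul_one_div_cancel hε.ne',
        one_mul]
      linarith
    gcongr
    linarith
  · obtain ⟨K, hK, h⟩ := exists_setLIntegral_le_of_limsup_moment hY hη hM
    set θ := η / (1 + η) with hθ
    have hθ0 : 0 < θ := by positivity
    -- With `I R > 1/θ`, the tail beyond `Rκ` is at most `e^{-a/θ}`, and the Hölder power `θ` brings
    -- it back to `e^{-a}`.
    obtain ⟨R, hR, hR1⟩ := ((hItop.eventually (lt_mem_nhds
      (ENNReal.ofReal_lt_top (r := 1 / θ)))).and (eventually_ge_atTop 1)).exists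
    refine ⟨1 + K, by linarith, ?_⟩
    filter_upwards [h, ha.eventually_gt_atTop 0, hmid R hR1 ε hε,
      eventually_rightTail_le hX hc hI hR1 (by positivity) hR] with i h ha hmid hR
    have hsub : {ω | κ i < X (τ i) ω} ⊆
        ({ω | κ i < X (τ i) ω} ∩ {ω | X (τ i) ω ≤ R * κ i}) ∪ {ω | R * κ i < X (τ i) ω} := by
      intro ω hω
      rcases le_or_gt (X (τ i) ω) (R * κ i) with h | h
      · exact Or.inl ⟨hω, h⟩
      · exact Or.inr h
    have hmeas : MeasurableSet ({ω | κ i < X (τ i) ω} ∩ {ω | X (τ i) ω ≤ R * κ i}) :=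
      (measurableSet_lt_logPrice hX _ _).inter
        (measurableSet_le (hX.measurable _) measurable_const)
    refine (lintegral_mono_set hsub).trans ((lintegral_union_le _ _ _).trans ?_)
    rw [add_mul, ENNReal.ofReal_add (by positivity) (by positivity)]
    refine add_le_add ?_ ?_
    · calc _ ≤ ∫⁻ _ω in {ω | κ i < X (τ i) ω} ∩ {ω | X (τ i) ω ≤ R * κ i},
            ENNReal.ofReal (Real.exp (ε * -logTail P X (κ i) (τ i))) ∂P :=
            setLIntegral_mono' hmeas fun ω hω => ENNReal.ofReal_le_ofReal (hmid ω hω.2)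
        _ ≤ ENNReal.ofReal (Real.exp (ε * -logTail P X (κ i) (τ i))) *
            P {ω | κ i < X (τ i) ω} := by
            rw [setLIntegral_const]
            gcongr
            exact Set.inter_subset_left
        _ ≤ ENNReal.ofReal (Real.exp (ε * -logTail P X (κ i) (τ i))) *
            ENNReal.ofReal (Real.exp (-(-logTail P X (κ i) (τ i)))) := by
            gcongr
            exact ENNReal.le_ofReal_iff_toReal_le (measure_ne_top _ _) (Real.exp_pos _).le |>.2
              (htail i)
        _ = _ := by
            rw [← ENNReal.ofReal_mul (Real.exp_pos _).le, ← Real.exp_add]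
            congr 2
            ring_nf
    · refine (h _ _ (measure_ne_top _ _) hR).trans (ENNReal.ofReal_le_ofReal ?_)
      have : θ * (1 / θ * -logTail P X (κ i) (τ i)) = -logTail P X (κ i) (τ i) := by
        field_simp
      rw [this]
      gcongr
      nlinarith

/-- `log (c / m) ∼ log P(X_t > κ)`, for a normalisation `m` of the call price which is dominated by
the strike. -/
theorem tendsto_neg_log_callPrice_div [IsProbabilityMeasure P]
    (hX : IsRiskNeutralLogPrice P ℱ X) (hκ : ∀ i, 0 < κ i)
    (hc : ∀ i, 0 < callPrice P X (κ i) (τ i)) (hI : RegularRightDecay P X l κ τ I)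
    {m : ι → ℝ} (hm : ∀ i, 0 < m i) {k : ℝ} (hk : 0 < k) (hmκ : ∀ᶠ i in l, k * m i ≤ κ i)
    {Y : ι → Ω → ℝ} (hY : ∀ i, Measurable (Y i))
    (hYc : ∀ i ω, κ i < X (τ i) ω → Real.exp (X (τ i) ω) - Real.exp (κ i) ≤ m i * Y i ω)
    (hmom : (∀ η : ℝ, 0 < η →
        limsup (fun i => ∫⁻ ω, ENNReal.ofReal (|Y i ω| ^ (1 + η)) ∂P) l < ⊤) ∨
      ((∃ η : ℝ, 0 < η ∧
        limsup (fun i => ∫⁻ ω, ENNReal.ofReal (|Y i ω| ^ (1 + η)) ∂P) l < ⊤) ∧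
        Tendsto I atTop (𝓝 ⊤)))
    (hmid : ∀ R : ℝ, 1 ≤ R → ∀ ε : ℝ, 0 < ε → ∀ᶠ i in l, ∀ ω, X (τ i) ω ≤ R * κ i →
      Y i ω ≤ Real.exp (ε * -logTail P X (κ i) (τ i))) :
    Tendsto (fun i => -Real.log (callPrice P X (κ i) (τ i) / m i) / -logTail P X (κ i) (τ i))
      l (𝓝 1) := by
  refine tendsto_div_one_of_bounds (tendsto_neg_logTail hX hc hI) (fun ε hε _ => ?_)
    (fun ε hε _ => ?_)
  · obtain ⟨K, hK, h⟩ := exists_setLIntegral_le_exp hX hc hI hY hmom hmid hε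
    refine ⟨Real.log K, ?_⟩
    filter_upwards [h] with i h
    have h1 := ofReal_callPrice_le hX (hYc i)
    simp_rw [ENNReal.ofReal_mul (hm i).le] at h1
    rw [lintegral_const_mul _ (by have := hY i; fun_prop)] at h1
    have h2 := h1.trans (mul_le_mul_right h _)
    rw [← ENNReal.ofReal_mul (hm i).le, ENNReal.ofReal_le_ofReal_iff
      (by have := hm i; positivity), mul_comm, ← div_le_iff₀ (hm i)] at h2
    have h3 := Real.log_le_log (div_pos (hc i) (hm i)) h2
    rw [Real.log_mul hK.ne' (Real.exp_pos _).ne', Real.log_exp] at h3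
    linarith
  · obtain ⟨k', hk', h⟩ := exists_mul_exp_le_callPrice hX hκ hc hI hε
    refine ⟨-Real.log (k' * k), ?_⟩
    filter_upwards [h, hmκ] with i h hmκ
    have h1 : k' * k * Real.exp (-((1 + ε) * -logTail P X (κ i) (τ i)))
        ≤ callPrice P X (κ i) (τ i) / m i := by
      rw [le_div_iff₀ (hm i)]
      refine le_trans ?_ h
      have : Real.exp (-((1 + ε) * -logTail P X (κ i) (τ i)))
          ≤ Real.exp (κ i - (1 + ε) * -logTail P X (κ i) (τ i)) :=
        Real.exp_le_exp.2 (by linarith [hκ i])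
      calc _ = k' * (k * m i) * Real.exp (-((1 + ε) * -logTail P X (κ i) (τ i))) := by ring
        _ ≤ _ := by have := hκ i; gcongr
    have h2 := Real.log_le_log (by positivity) h1
    rw [Real.log_mul (by positivity) (Real.exp_pos _).ne', Real.log_exp] at h2
    linarith

/-! ### Exponential moments and the gap `a - κ` -/

theorem ExpMomentCondition.limsup_lt_top {η : ℝ} (h : ExpMomentCondition P X l τ η) :
    limsup (fun i => ∫⁻ ω, ENNReal.ofReal (|Real.exp (X (τ i) ω)| ^ (1 + η)) ∂P) l < ⊤ := by
  have e : ∀ x : ℝ, |Real.exp x| ^ (1 + η) = Real.exp ((1 + η) * x) := fun x => by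
    rw [abs_of_pos (Real.exp_pos _), ← Real.exp_mul, mul_comm]
  simp_rw [e]
  exact h

/-- Markov's inequality for an exponential moment. -/
theorem ExpMomentCondition.exists_mul_le [IsProbabilityMeasure P]
    (hX : IsRiskNeutralLogPrice P ℱ X) (hc : ∀ i, 0 < callPrice P X (κ i) (τ i))
    {η : ℝ} (hη : 0 < η) (h : ExpMomentCondition P X l τ η) :
    ∃ K : ℝ, 0 ≤ K ∧ ∀ᶠ i in l, (1 + η) * κ i ≤ -logTail P X (κ i) (τ i) + K := by
  obtain ⟨M, hM1, hM2⟩ := exists_between (show limsup _ l < ⊤ from h)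
  refine ⟨Real.log (M.toReal + 1), Real.log_nonneg (by linarith [M.toReal_nonneg]), ?_⟩
  filter_upwards [eventually_lt_of_limsup_lt hM1] with i hi
  have h1 : ENNReal.ofReal (Real.exp ((1 + η) * κ i)) * rightTail P X (κ i) (τ i) ≤ M := by
    calc _ = ∫⁻ _ω in {ω | κ i < X (τ i) ω}, ENNReal.ofReal (Real.exp ((1 + η) * κ i)) ∂P := by
          rw [setLIntegral_const]; rfl
      _ ≤ ∫⁻ ω in {ω | κ i < X (τ i) ω},
            ENNReal.ofReal (Real.exp ((1 + η) * X (τ i) ω)) ∂P := by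
          refine setLIntegral_mono' (measurableSet_lt_logPrice hX _ _) fun ω hω => ?_
          have : κ i < X (τ i) ω := hω
          gcongr
      _ ≤ _ := (setLIntegral_le_lintegral _ _).trans hi.le
  have h2 := ENNReal.toReal_mono hM2.ne h1
  rw [ENNReal.toReal_mul, ENNReal.toReal_ofReal (Real.exp_pos _).le, ← exp_logTail hX (hc i),
    ← Real.exp_add] at h2
  have h3 := (Real.le_log_iff_exp_le (by linarith [M.toReal_nonneg])).2
    (h2.trans (le_add_of_nonneg_right zero_le_one))
  linarith

/-- Markov's bound `(1+η)κ ≤ a + K` gives `a - κ ≥ (ηa - K)/(1+η)`, and half of `ηa` absorbs `K`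
once `a ≥ 2K/η`. -/
theorem ExpMomentCondition.exists_mul_le_sub [IsProbabilityMeasure P]
    (hX : IsRiskNeutralLogPrice P ℱ X) (hc : ∀ i, 0 < callPrice P X (κ i) (τ i))
    (hI : RegularRightDecay P X l κ τ I)
    {η : ℝ} (hη : 0 < η) (h : ExpMomentCondition P X l τ η) :
    ∃ θ : ℝ, 0 < θ ∧ ∀ᶠ i in l,
      θ * -logTail P X (κ i) (τ i) ≤ -logTail P X (κ i) (τ i) - κ i := by
  obtain ⟨K, hK, hb⟩ := h.exists_mul_le hX hc hη
  refine ⟨η / (2 * (1 + η)), by positivity, ?_⟩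
  filter_upwards [hb, (tendsto_neg_logTail hX hc hI).eventually_ge_atTop (2 * K / η)] with i h1 h2
  rw [div_le_iff₀ hη] at h2
  rw [div_mul_eq_mul_div, div_le_iff₀ (by positivity)]
  linarith

/-- Reduces the all-moments alternative of (i) to the special case, by Markov's inequality with `η`
arbitrarily large. -/
theorem tendsto_neg_logTail_div_atTop [IsProbabilityMeasure P]
    (hX : IsRiskNeutralLogPrice P ℱ X) (hκ : ∀ i, 0 < κ i)
    (hc : ∀ i, 0 < callPrice P X (κ i) (τ i)) (hI : RegularRightDecay P X l κ τ I)
    (h : ∀ η : ℝ, 0 < η → ExpMomentCondition P X l τ η) :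
    Tendsto (fun i => -logTail P X (κ i) (τ i) / κ i) l atTop := by
  rw [tendsto_atTop]
  intro b
  have hη : 0 < 2 * (|b| + 1) := by positivity
  obtain ⟨K, hK, hb⟩ := (h _ hη).exists_mul_le hX hc hη
  filter_upwards [hb, (tendsto_neg_logTail hX hc hI).eventually_ge_atTop K] with i h1 h2
  rw [le_div_iff₀ (hκ i)]
  nlinarith [hκ i, le_abs_self b]

/-- If the tail decays at least as fast as a power of itself along multiples of the strike, then
the tail expectation of the price is at most `exp (-(1 - ε) (a - κ))` with
`a = -log P(X_t > κ)`, up to a constant. -/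
theorem exists_setLIntegral_exp_le [IsProbabilityMeasure P]
    (hX : IsRiskNeutralLogPrice P ℱ X) (hκ : ∀ i, 0 < κ i)
    (hc : ∀ i, 0 < callPrice P X (κ i) (τ i)) (hI : RegularRightDecay P X l κ τ I)
    {η : ℝ} (hη : 0 < η) (hM : ExpMomentCondition P X l τ η)
    (hIρ : ∀ ρ : ℝ, 1 ≤ ρ → ENNReal.ofReal ρ ≤ I ρ) {ε : ℝ} (hε : 0 < ε) (hε1 : ε < 1) :
    ∃ K : ℝ, 0 ≤ K ∧ ∀ᶠ i in l,
      ∫⁻ ω in {ω | κ i < X (τ i) ω}, ENNReal.ofReal (Real.exp (X (τ i) ω)) ∂P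
        ≤ ENNReal.ofReal (K * Real.exp (-((1 - ε) * (-logTail P X (κ i) (τ i) - κ i)))) := by
  have ha := tendsto_neg_logTail hX hc hI
  obtain ⟨θ, hθ, hgap⟩ := hM.exists_mul_le_sub hX hc hI hη
  -- The bound is proved far out by Hölder, then carried down to `ρ = 1` in finitely many slabs of
  -- width `sκ`.
  let Q : ℝ → Prop := fun ρ => ∃ K : ℝ, 0 ≤ K ∧ ∀ᶠ i in l,
      ∫⁻ ω in {ω | ρ * κ i < X (τ i) ω}, ENNReal.ofReal (Real.exp (X (τ i) ω)) ∂P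
        ≤ ENNReal.ofReal (K * Real.exp (-((1 - ε) * (-logTail P X (κ i) (τ i) - κ i))))
  -- Chosen so that `2sa = εθa ≤ ε(a - κ)`.
  set s := ε * θ / 2 with hs
  have hs0 : 0 < s := by positivity
  have hs1 : ∀ ρ : ℝ, 1 ≤ ρ → 0 < ρ → ENNReal.ofReal (ρ - s) < I ρ := fun ρ hρ hρ0 =>
    lt_of_lt_of_le ((ENNReal.ofReal_lt_ofReal_iff hρ0).2 (by linarith)) (hIρ ρ hρ)
  have hstep : ∀ ρ : ℝ, 1 ≤ ρ → Q (ρ + s) → Q ρ := by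
    rintro ρ hρ ⟨K, hK, hQ⟩
    refine ⟨1 + K, by linarith, ?_⟩
    have hev : ∀ᶠ i in l, (rightTail P X (ρ * κ i) (τ i)).toReal
        ≤ Real.exp (-((ρ - s) * -logTail P X (κ i) (τ i))) := by
      -- Nothing forces `s ≤ 1`; if `ρ - s ≤ 0` the bound is at least `1`, hence trivial.
      rcases le_total 0 (ρ - s) with h0 | h0
      · exact eventually_rightTail_le hX hc hI hρ h0 (hs1 ρ hρ (by linarith))
      · filter_upwards [ha.eventually_gt_atTop 0] with i ha
        refine (measureReal_le_one (μ := P)).trans (Real.one_le_exp ?_)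
        nlinarith
    filter_upwards [hQ, hgap, ha.eventually_gt_atTop 0, hev] with i hQ hgap ha hF
    have hsub : {ω | ρ * κ i < X (τ i) ω} ⊆
        ({ω | ρ * κ i < X (τ i) ω} ∩ {ω | X (τ i) ω ≤ (ρ + s) * κ i}) ∪
          {ω | (ρ + s) * κ i < X (τ i) ω} := by
      intro ω hω
      rcases le_or_gt (X (τ i) ω) ((ρ + s) * κ i) with h | h
      · exact Or.inl ⟨hω, h⟩
      · exact Or.inr h
    have hmeas : MeasurableSet
        ({ω | ρ * κ i < X (τ i) ω} ∩ {ω | X (τ i) ω ≤ (ρ + s) * κ i}) :=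
      (measurableSet_lt_logPrice hX _ _).inter
        (measurableSet_le (hX.measurable _) measurable_const)
    refine (lintegral_mono_set hsub).trans ((lintegral_union_le _ _ _).trans ?_)
    rw [add_mul 1 K, ENNReal.ofReal_add (by positivity) (by positivity)]
    refine add_le_add ?_ hQ
    calc _ ≤ ∫⁻ _ω in {ω | ρ * κ i < X (τ i) ω} ∩ {ω | X (τ i) ω ≤ (ρ + s) * κ i},
          ENNReal.ofReal (Real.exp ((ρ + s) * κ i)) ∂P :=
          setLIntegral_mono' hmeas fun ω hω =>
            ENNReal.ofReal_le_ofReal (Real.exp_le_exp.2 hω.2)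
      _ ≤ ENNReal.ofReal (Real.exp ((ρ + s) * κ i)) * P {ω | ρ * κ i < X (τ i) ω} := by
          rw [setLIntegral_const]
          gcongr
          exact Set.inter_subset_left
      _ ≤ ENNReal.ofReal (Real.exp ((ρ + s) * κ i)) *
          ENNReal.ofReal (Real.exp (-((ρ - s) * -logTail P X (κ i) (τ i)))) := by
          gcongr
          exact ENNReal.le_ofReal_iff_toReal_le (measure_ne_top _ _) (Real.exp_pos _).le |>.2 hF
      _ ≤ _ := by
          rw [← ENNReal.ofReal_mul (Real.exp_pos _).le, ← Real.exp_add, one_mul]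
          refine ENNReal.ofReal_le_ofReal (Real.exp_le_exp.2 ?_)
          set a := -logTail P X (κ i) (τ i)
          have h1 : 0 < a - κ i := by have := mul_pos hθ ha; linarith
          -- The exponent is `(ρ+s)κ - (ρ-s)a = -ρ(a-κ) + s(a+κ)`, at most `-(a-κ) + 2sa`.
          have h2 : 2 * s * a ≤ ε * (a - κ i) := by
            rw [hs]; nlinarith
          have h3 : s * κ i ≤ s * a := by gcongr; linarith
          nlinarith
  have hbase : ∃ R₀ : ℝ, ∀ R : ℝ, R₀ ≤ R → Q R := by
    have hmeas : ∀ i, Measurable fun ω => Real.exp (X (τ i) ω) := fun i =>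
      Real.measurable_exp.comp (hX.measurable (τ i))
    obtain ⟨K, hK, h⟩ := exists_setLIntegral_le_of_limsup_moment hmeas hη hM.limsup_lt_top
    set θ' := η / (1 + η) with hθ'
    have hθ'0 : 0 < θ' := by positivity
    -- For such `R`, `θ'(R - s) ≥ 1`, so Hölder's inequality already yields `e^{-a}`.
    refine ⟨s + 1 + 1 / θ', fun R hR => ⟨K, hK, ?_⟩⟩
    have hinv : 0 < 1 / θ' := by positivity
    filter_upwards [h, hgap, ha.eventually_gt_atTop 0, eventually_rightTail_le hX hc hI
      (ρ := R) (r := R - s) (by linarith) (by linarith) (hs1 R (by linarith) (by linarith))]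
      with i h hgap ha hF
    refine (h _ _ (measure_ne_top _ _) hF).trans (ENNReal.ofReal_le_ofReal ?_)
    refine mul_le_mul_of_nonneg_left (Real.exp_le_exp.2 (neg_le_neg ?_)) hK
    set a := -logTail P X (κ i) (τ i)
    have h1 : 0 < a - κ i := by have := mul_pos hθ ha; linarith
    have h2 : 1 ≤ θ' * (R - s) := by
      have : θ' * (1 / θ') = 1 := by field_simp
      nlinarith
    have h3 : (1 - ε) * (a - κ i) ≤ a := by nlinarith [hκ i]
    nlinarith
  obtain ⟨R₀, hR₀⟩ := hbase
  obtain ⟨n, hn⟩ := exists_nat_ge (R₀ / s)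
  rw [div_le_iff₀ hs0] at hn
  have hdown : ∀ n : ℕ, Q (1 + n * s) → Q 1 := by
    intro n
    induction n with
    | zero => simp
    | succ n ih =>
      intro h
      refine ih (hstep _ (by nlinarith [Nat.cast_nonneg (α := ℝ) n]) ?_)
      convert h using 1
      push_cast
      ring
  have h1 := hdown n (hR₀ _ (by linarith))
  simpa [Q] using h1

theorem tendsto_neg_logTail_sub [IsProbabilityMeasure P]
    (hX : IsRiskNeutralLogPrice P ℱ X)
    (hc : ∀ i, 0 < callPrice P X (κ i) (τ i)) (hI : RegularRightDecay P X l κ τ I)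
    {θ : ℝ} (hθ : 0 < θ) (hgap : ∀ᶠ i in l,
      θ * -logTail P X (κ i) (τ i) ≤ -logTail P X (κ i) (τ i) - κ i) :
    Tendsto (fun i => -logTail P X (κ i) (τ i) - κ i) l atTop :=
  tendsto_atTop_mono' l hgap ((tendsto_neg_logTail hX hc hI).const_mul_atTop hθ)

theorem tendsto_neg_log_callPrice_div_sub [IsProbabilityMeasure P]
    (hX : IsRiskNeutralLogPrice P ℱ X) (hκ : ∀ i, 0 < κ i)
    (hc : ∀ i, 0 < callPrice P X (κ i) (τ i)) (hI : RegularRightDecay P X l κ τ I)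
    {δ : ℝ} (hδ : 0 < δ) (hδκ : ∀ᶠ i in l, δ ≤ κ i)
    {η : ℝ} (hη : 0 < η) (hM : ExpMomentCondition P X l τ η)
    (hIρ : ∀ ρ : ℝ, 1 ≤ ρ → ENNReal.ofReal ρ ≤ I ρ) :
    Tendsto (fun i => -Real.log (callPrice P X (κ i) (τ i)) /
      (-logTail P X (κ i) (τ i) - κ i)) l (𝓝 1) := by
  obtain ⟨θ, hθ, hgap⟩ := hM.exists_mul_le_sub hX hc hI hη
  refine tendsto_div_one_of_bounds (tendsto_neg_logTail_sub hX hc hI hθ hgap)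
    (fun ε hε hε1 => ?_) (fun ε hε _ => ?_)
  · obtain ⟨K, hK, h⟩ := exists_setLIntegral_exp_le hX hκ hc hI hη hM hIρ hε hε1
    refine ⟨Real.log (K + 1), ?_⟩
    filter_upwards [h] with i h
    have h1 := (ofReal_callPrice_le hX (κ := κ i) (t := τ i)
      (Y := fun ω => Real.exp (X (τ i) ω))
      (fun ω _ => by linarith [Real.exp_pos (κ i)])).trans h
    rw [ENNReal.ofReal_le_ofReal_iff (by positivity)] at h1
    have h2 := Real.log_le_log (hc i) (h1.trans (mul_le_mul_of_nonneg_right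
      (le_add_of_nonneg_right zero_le_one) (Real.exp_pos _).le))
    rw [Real.log_mul (by positivity) (Real.exp_pos _).ne', Real.log_exp] at h2
    linarith
  -- Precision `εθ` in units of `a` is at most `ε` in units of `a - κ`.
  · obtain ⟨k, hk, h⟩ := exists_mul_exp_le_callPrice hX hκ hc hI (mul_pos hε hθ)
    refine ⟨-Real.log (k * δ), ?_⟩
    filter_upwards [h, hδκ, hgap] with i h hδκ hgap
    have h1 : k * δ * Real.exp (κ i - (1 + ε * θ) * -logTail P X (κ i) (τ i))
        ≤ callPrice P X (κ i) (τ i) := le_trans (by gcongr) h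
    have h2 := Real.log_le_log (by positivity) h1
    rw [Real.log_mul (by positivity) (Real.exp_pos _).ne', Real.log_exp] at h2
    have h3 := mul_le_mul_of_nonneg_left hgap hε.le
    linarith

/-! ### From price asymptotics to implied volatility -/

/-- Rationalising the difference of roots gives the solution of the quadratic with `d² = 2(a - κ)`.
-/
theorem volFormula_eq {κ : ℝ} {t : ℝ≥0} (hκ : 0 < κ) (ht : 0 < t)
    (h : 0 < -logTail P X κ t - κ) :
    volFormula P X κ t = 2 * κ / (√(2 * (-logTail P X κ t - κ) + 2 * κ) +
      √(2 * (-logTail P X κ t - κ))) / √(t : ℝ) := by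
  have ht' : (0 : ℝ) < t := by exact_mod_cast ht
  unfold volFormula
  set a := -logTail P X κ t
  have ha : 0 < a := by linarith
  have e1 : √(a / κ) = √(2 * a) / √(2 * κ) := by
    rw [← Real.sqrt_div' _ (by positivity)]; congr 1; field_simp
  have e2 : √(a / κ - 1) = √(2 * (a - κ)) / √(2 * κ) := by
    rw [← Real.sqrt_div' _ (by positivity)]; congr 1; field_simp
  have e3 : √(2 * κ / t) = √(2 * κ) / √(t : ℝ) := Real.sqrt_div' _ ht'.le
  have e4 : 2 * (a - κ) + 2 * κ = 2 * a := by ring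
  rw [e1, e2, e3, e4]
  have p1 : 0 < √(2 * κ) := by positivity
  have p2 : 0 < √(t : ℝ) := by positivity
  have p3 : 0 < √(2 * a) := by positivity
  have p4 : 0 < √(2 * (a - κ)) := Real.sqrt_pos.2 (by linarith)
  have s1 : √(2 * a) ^ 2 = 2 * a := Real.sq_sqrt (by positivity)
  have s2 : √(2 * (a - κ)) ^ 2 = 2 * (a - κ) := Real.sq_sqrt (by linarith)
  field_simp
  linarith

theorem simpleVolFormula_eq {κ : ℝ} {t : ℝ≥0} :
    simpleVolFormula P X κ t = κ / √(2 * -logTail P X κ t) / √(t : ℝ) := by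
  unfold simpleVolFormula
  rw [show 2 * (t : ℝ) * -logTail P X κ t = (2 * -logTail P X κ t) * t by ring,
    Real.sqrt_mul' _ t.coe_nonneg, div_div]

theorem exists_pos_blackScholesCall_eq [IsProbabilityMeasure P]
    (hX : IsRiskNeutralLogPrice P ℱ X) {κ : ℝ} {t : ℝ≥0} (hκ : 0 < κ) (ht : 0 < t)
    (hc : 0 < callPrice P X κ t) :
    ∃ v : ℝ, 0 < v ∧ blackScholesCall κ v = callPrice P X κ t ∧
      impliedVolatility P X κ t = v / √(t : ℝ) := by
  obtain ⟨h0, h⟩ := isImpliedVolatility_impliedVolatility hX hκ ht hc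
  have hs : 0 < √(t : ℝ) := Real.sqrt_pos.2 (by exact_mod_cast ht)
  refine ⟨_, lt_of_le_of_ne (mul_nonneg h0 hs.le) fun h1 => ?_, h, ?_⟩
  · rw [← h1, blackScholesCall_zero hκ] at h
    exact hc.ne h
  · rw [mul_div_cancel_right₀ _ hs.ne']

theorem tendsto_atTop_of_div_tendsto_one {f b : ι → ℝ} (hb : Tendsto b l atTop)
    (h : Tendsto (fun i => f i / b i) l (𝓝 1)) : Tendsto f l atTop := by
  refine (hb.atTop_mul_pos one_pos h).congr' ?_
  filter_upwards [hb.eventually_gt_atTop 0] with i hi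
  field_simp

theorem ratioEquiv_impliedVolatility_volFormula [IsProbabilityMeasure P]
    (hX : IsRiskNeutralLogPrice P ℱ X) (hκ : ∀ i, 0 < κ i) (hτ : ∀ i, 0 < τ i)
    (hc : ∀ i, 0 < callPrice P X (κ i) (τ i))
    {δ : ℝ} (hδ : 0 < δ) (hδκ : ∀ᶠ i in l, δ ≤ κ i)
    (hb : Tendsto (fun i => -logTail P X (κ i) (τ i) - κ i) l atTop)
    (hL : Tendsto (fun i => -Real.log (callPrice P X (κ i) (τ i)) /
      (-logTail P X (κ i) (τ i) - κ i)) l (𝓝 1)) :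
    RatioEquiv l (fun i => impliedVolatility P X (κ i) (τ i))
      (fun i => volFormula P X (κ i) (τ i)) := by
  choose v hv hvc hvσ using fun i => exists_pos_blackScholesCall_eq hX (hκ i) (hτ i) (hc i)
  simp_rw [← hvc] at hc hL
  have hLtop := tendsto_atTop_of_div_tendsto_one hb hL
  obtain ⟨h1, h2⟩ := tendsto_div_sqrt_neg_log_blackScholesCall hδ hδκ hv hc hLtop
  refine (tendsto_div_of_tendsto_div_sqrt hκ hv hLtop (hb.eventually_gt_atTop 0) h1 h2 hL).congr' ?_
  filter_upwards [hb.eventually_gt_atTop 0] with i hi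
  have hs : √(τ i : ℝ) ≠ 0 := (Real.sqrt_pos.2 (by exact_mod_cast hτ i)).ne'
  rw [volFormula_eq (hκ i) (hτ i) hi, hvσ, div_div_div_cancel_right₀ hs]

theorem ratioEquiv_impliedVolatility_simpleVolFormula
    (hκ : ∀ i, 0 < κ i) (hτ : ∀ i, 0 < τ i) {v L : ι → ℝ} (hv : ∀ i, 0 < v i)
    (hvσ : ∀ i, impliedVolatility P X (κ i) (τ i) = v i / √(τ i : ℝ))
    (ha : Tendsto (fun i => -logTail P X (κ i) (τ i)) l atTop)
    (hκa : Tendsto (fun i => κ i / -logTail P X (κ i) (τ i)) l (𝓝 0))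
    (hL : Tendsto (fun i => L i / -logTail P X (κ i) (τ i)) l (𝓝 1))
    (hd : Tendsto (fun i => κ i / v i - v i / 2) l atTop)
    (hdL : Tendsto (fun i => (κ i / v i - v i / 2) / √(2 * L i)) l (𝓝 1)) :
    RatioEquiv l (fun i => impliedVolatility P X (κ i) (τ i))
      (fun i => simpleVolFormula P X (κ i) (τ i)) := by
  have hLtop := tendsto_atTop_of_div_tendsto_one ha hL
  refine (tendsto_div_simple_of_tendsto_div_sqrt hκ hv hLtop ha hd hdL hL hκa).congr fun i => ?_
  have hs : √(τ i : ℝ) ≠ 0 := (Real.sqrt_pos.2 (by exact_mod_cast hτ i)).ne'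
  simp only [simpleVolFormula_eq, hvσ, div_div_div_cancel_right₀ hs]

theorem ratioEquiv_of_neg {f g : ι → ℝ} (h : Tendsto (fun i => -f i / -g i) l (𝓝 1)) :
    RatioEquiv l f g := by
  simpa only [RatioEquiv, neg_div_neg_eq] using h

/-! ### Superlinear and vanishing-strike regimes -/

/-- The regime `κ = o(log P(X_t > κ))` with strikes bounded away from zero. -/
theorem tendsto_neg_log_callPrice_div_of_superlinear [IsProbabilityMeasure P]
    (hX : IsRiskNeutralLogPrice P ℱ X) (hκ : ∀ i, 0 < κ i)
    (hc : ∀ i, 0 < callPrice P X (κ i) (τ i)) (hI : RegularRightDecay P X l κ τ I)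
    {δ : ℝ} (hδ : 0 < δ) (hδκ : ∀ᶠ i in l, δ ≤ κ i)
    (hsup : Tendsto (fun i => -logTail P X (κ i) (τ i) / κ i) l atTop)
    (hmom : (∀ η : ℝ, 0 < η → ExpMomentCondition P X l τ η) ∨
      ((∃ η : ℝ, 0 < η ∧ ExpMomentCondition P X l τ η) ∧ Tendsto I atTop (𝓝 ⊤))) :
    Tendsto (fun i => -Real.log (callPrice P X (κ i) (τ i)) / -logTail P X (κ i) (τ i))
      l (𝓝 1) := by
  have h := tendsto_neg_log_callPrice_div hX hκ hc hI (m := fun _ => 1) (fun _ => one_pos) hδ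
    (by simpa using hδκ) (Y := fun i ω => Real.exp (X (τ i) ω))
    (fun i => Real.measurable_exp.comp (hX.measurable (τ i)))
    (fun i ω _ => by linarith [Real.exp_pos (κ i)])
    (hmom.imp (fun h η hη => (h η hη).limsup_lt_top)
      (fun ⟨⟨η, hη, h⟩, hI⟩ => ⟨⟨η, hη, h.limsup_lt_top⟩, hI⟩)) ?_
  · simpa using h
  · intro R hR ε hε
    filter_upwards [hsup.eventually_ge_atTop (R / ε)] with i hi ω hω
    rw [div_le_div_iff₀ hε (hκ i)] at hi
    exact Real.exp_le_exp.2 (by linarith)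

/-- The regime of vanishing strikes. -/
theorem tendsto_neg_log_callPrice_div_strike [IsProbabilityMeasure P]
    (hX : IsRiskNeutralLogPrice P ℱ X) (hκ : ∀ i, 0 < κ i)
    (hc : ∀ i, 0 < callPrice P X (κ i) (τ i)) (hI : RegularRightDecay P X l κ τ I)
    (hκ0 : Tendsto κ l (𝓝 0))
    (hmom : (∀ η : ℝ, 0 < η → ScaledMomentCondition P X l κ τ η) ∨
      ((∃ η : ℝ, 0 < η ∧ ScaledMomentCondition P X l κ τ η) ∧ Tendsto I atTop (𝓝 ⊤))) :
    Tendsto (fun i => -Real.log (callPrice P X (κ i) (τ i) / κ i) / -logTail P X (κ i) (τ i))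
      l (𝓝 1) := by
  refine tendsto_neg_log_callPrice_div hX hκ hc hI hκ one_pos
    (Eventually.of_forall fun i => (one_mul _).le)
    (Y := fun i ω => (Real.exp (X (τ i) ω) - 1) / κ i)
    (fun i => ((Real.measurable_exp.comp (hX.measurable (τ i))).sub_const 1).div_const _)
    (fun i ω _ => ?_) hmom ?_
  · rw [mul_div_cancel₀ _ (hκ i).ne']
    linarith [Real.one_le_exp (hκ i).le]
  · intro R hR ε hε
    have hR0 : 0 < R := by linarith
    filter_upwards [hκ0.eventually (gt_mem_nhds (show (0 : ℝ) < 1 / R by positivity)),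
      (tendsto_neg_logTail hX hc hI).eventually_ge_atTop (2 * R / ε)] with i h1 h2 ω hω
    rw [lt_div_iff₀ hR0] at h1
    rw [div_le_iff₀ hε] at h2
    -- Valid once `Rκ < 1`. The scaled payoff up to `Rκ` is then bounded by `2R`, which `εa`, and so
    -- `e^{εa}`, eventually exceeds.
    have h3 : Real.exp (R * κ i) - 1 ≤ 2 * (R * κ i) := by
      have h0 : 0 ≤ R * κ i := by have := hκ i; positivity
      have := Real.abs_exp_sub_one_le (x := R * κ i) (by rw [abs_of_nonneg h0]; linarith)
      rw [abs_of_nonneg h0] at this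
      exact (le_abs_self _).trans this
    have h4 : (Real.exp (X (τ i) ω) - 1) / κ i ≤ 2 * R := by
      rw [div_le_iff₀ (hκ i)]
      linarith [Real.exp_le_exp.2 hω]
    linarith [Real.add_one_le_exp (ε * -logTail P X (κ i) (τ i))]

/-- Subtracting a strike of smaller order does not change the asymptotics. -/
theorem tendsto_div_sub_of_superlinear {f a κ : ι → ℝ} (ha : Tendsto a l atTop)
    (hκa : Tendsto (fun i => κ i / a i) l (𝓝 0)) (h : Tendsto (fun i => f i / a i) l (𝓝 1)) :
    Tendsto (fun i => a i - κ i) l atTop ∧ Tendsto (fun i => f i / (a i - κ i)) l (𝓝 1) := by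
  have h1 : Tendsto (fun i => (a i - κ i) / a i) l (𝓝 1) := by
    have := hκa.const_sub 1
    rw [sub_zero] at this
    refine this.congr' ?_
    filter_upwards [ha.eventually_gt_atTop 0] with i hi
    field_simp
  refine ⟨tendsto_atTop_of_div_tendsto_one ha h1, ?_⟩
  have h2 := h.div h1 one_ne_zero
  rw [div_one] at h2
  refine h2.congr' ?_
  filter_upwards [ha.eventually_gt_atTop 0] with i hi
  exact div_div_div_cancel_right₀ hi.ne' _ _

end Model

end OptionAsymptotics

end

/-! ### The theorem -/

open OptionAsymptotics in
theorem theorem2p3 {Ω : Type*} {mΩ : MeasurableSpace Ω} (P : Measure Ω) [IsProbabilityMeasure P]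
    (ℱ : Filtration ℝ≥0 mΩ) (X : ℝ≥0 → Ω → ℝ) (hX : IsRiskNeutralLogPrice P ℱ X)
    {ι : Type*} (l : Filter ι) (κ : ι → ℝ) (τ : ι → ℝ≥0)
    (hκ : ∀ i, 0 < κ i) (hτ : ∀ i, 0 < τ i)
    (hc : ∀ i, 0 < callPrice P X (κ i) (τ i))
    (I : ℝ → ℝ≥0∞) (hI : RegularRightDecay P X l κ τ I) :
    -- the implied volatility is well defined
    (∀ i, ∃! σ : ℝ, IsImpliedVolatility P X (κ i) (τ i) σ) ∧
    -- (i) `κ` bounded away from zero, `t` bounded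
    (StrikeAwayFromZero l κ τ →
      ((∀ η : ℝ, 0 < η → ExpMomentCondition P X l τ η) ∨
        ((∃ η : ℝ, 0 < η ∧ ExpMomentCondition P X l τ η) ∧
          ∀ ρ : ℝ, 1 ≤ ρ → ENNReal.ofReal ρ ≤ I ρ)) →
      RatioEquiv l (fun i => Real.log (callPrice P X (κ i) (τ i)))
        (fun i => logTail P X (κ i) (τ i) + κ i) ∧
      RatioEquiv l (fun i => impliedVolatility P X (κ i) (τ i))
        (fun i => volFormula P X (κ i) (τ i))) ∧
    -- (i), special case
    (StrikeAwayFromZero l κ τ →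
      Tendsto (fun i => -logTail P X (κ i) (τ i) / κ i) l atTop →
      ((∀ η : ℝ, 0 < η → ExpMomentCondition P X l τ η) ∨
        ((∃ η : ℝ, 0 < η ∧ ExpMomentCondition P X l τ η) ∧ Tendsto I atTop (𝓝 ⊤))) →
      RatioEquiv l (fun i => Real.log (callPrice P X (κ i) (τ i)))
        (fun i => logTail P X (κ i) (τ i) + κ i) ∧
      RatioEquiv l (fun i => impliedVolatility P X (κ i) (τ i))
        (fun i => volFormula P X (κ i) (τ i)) ∧
      RatioEquiv l (fun i => Real.log (callPrice P X (κ i) (τ i)))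
        (fun i => logTail P X (κ i) (τ i)) ∧
      RatioEquiv l (fun i => impliedVolatility P X (κ i) (τ i))
        (fun i => simpleVolFormula P X (κ i) (τ i))) ∧
    -- (ii) `κ` and `t` vanish
    (Tendsto κ l (𝓝 0) → Tendsto τ l (𝓝 0) →
      ((∀ η : ℝ, 0 < η → ScaledMomentCondition P X l κ τ η) ∨
        ((∃ η : ℝ, 0 < η ∧ ScaledMomentCondition P X l κ τ η) ∧ Tendsto I atTop (𝓝 ⊤))) →
      RatioEquiv l (fun i => Real.log (callPrice P X (κ i) (τ i) / κ i))
        (fun i => logTail P X (κ i) (τ i)) ∧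
      RatioEquiv l (fun i => impliedVolatility P X (κ i) (τ i))
        (fun i => simpleVolFormula P X (κ i) (τ i))) := by
  have ha := tendsto_neg_logTail hX hc hI
  have hspecial : StrikeAwayFromZero l κ τ →
      Tendsto (fun i => -logTail P X (κ i) (τ i) / κ i) l atTop →
      ((∀ η : ℝ, 0 < η → ExpMomentCondition P X l τ η) ∨
        ((∃ η : ℝ, 0 < η ∧ ExpMomentCondition P X l τ η) ∧ Tendsto I atTop (𝓝 ⊤))) →
      RatioEquiv l (fun i => Real.log (callPrice P X (κ i) (τ i)))
        (fun i => logTail P X (κ i) (τ i) + κ i) ∧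
      RatioEquiv l (fun i => impliedVolatility P X (κ i) (τ i))
        (fun i => volFormula P X (κ i) (τ i)) ∧
      RatioEquiv l (fun i => Real.log (callPrice P X (κ i) (τ i)))
        (fun i => logTail P X (κ i) (τ i)) ∧
      RatioEquiv l (fun i => impliedVolatility P X (κ i) (τ i))
        (fun i => simpleVolFormula P X (κ i) (τ i)) := by
    rintro ⟨⟨δ, hδ, hδκ⟩, -⟩ hsup hmom
    have hL := tendsto_neg_log_callPrice_div_of_superlinear hX hκ hc hI hδ hδκ hsup hmom
    have hκa : Tendsto (fun i => κ i / -logTail P X (κ i) (τ i)) l (𝓝 0) := by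
      simpa only [Function.comp_def, inv_div] using tendsto_inv_atTop_zero.comp hsup
    obtain ⟨hb, hLb⟩ := tendsto_div_sub_of_superlinear ha hκa hL
    refine ⟨ratioEquiv_of_neg (by simpa only [neg_add, sub_eq_add_neg] using hLb),
      ratioEquiv_impliedVolatility_volFormula hX hκ hτ hc hδ hδκ hb hLb, ratioEquiv_of_neg hL, ?_⟩
    choose v hv hvc hvσ using fun i => exists_pos_blackScholesCall_eq hX (hκ i) (hτ i) (hc i)
    have hLtop := tendsto_atTop_of_div_tendsto_one ha hL
    simp_rw [← hvc] at hL hLtop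
    obtain ⟨hd, hdL⟩ := tendsto_div_sqrt_neg_log_blackScholesCall hδ hδκ hv
      (fun i => (hvc i).symm ▸ hc i) hLtop
    exact ratioEquiv_impliedVolatility_simpleVolFormula hκ hτ hv hvσ ha hκa hL hd hdL
  refine ⟨fun i => existsUnique_isImpliedVolatility hX (hκ i) (hτ i) (hc i), ?_, hspecial, ?_⟩
  · rintro hS (hall | ⟨⟨η, hη, hM⟩, hIρ⟩)
    -- All exponential moments force `a/κ → ∞`, so this is an instance of the special case.
    · obtain ⟨h1, h2, -⟩ := hspecial hS (tendsto_neg_logTail_div_atTop hX hκ hc hI hall)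
        (Or.inl hall)
      exact ⟨h1, h2⟩
    · obtain ⟨⟨δ, hδ, hδκ⟩, -⟩ := hS
      obtain ⟨θ, hθ, hgap⟩ := hM.exists_mul_le_sub hX hc hI hη
      have hb := tendsto_neg_logTail_sub hX hc hI hθ hgap
      have hLb := tendsto_neg_log_callPrice_div_sub hX hκ hc hI hδ hδκ hη hM hIρ
      exact ⟨ratioEquiv_of_neg (by simpa only [neg_add, sub_eq_add_neg] using hLb),
        ratioEquiv_impliedVolatility_volFormula hX hκ hτ hc hδ hδκ hb hLb⟩
  · intro hκ0 _ hmom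
    have hL := tendsto_neg_log_callPrice_div_strike hX hκ hc hI hκ0 hmom
    refine ⟨ratioEquiv_of_neg hL, ?_⟩
    choose v hv hvc hvσ using fun i => exists_pos_blackScholesCall_eq hX (hκ i) (hτ i) (hc i)
    have hLtop := tendsto_atTop_of_div_tendsto_one ha hL
    simp_rw [← hvc] at hL hLtop
    obtain ⟨hd, hdL⟩ := tendsto_div_sqrt_neg_log_blackScholesCall_div hκ hκ0 hv
      (fun i => (hvc i).symm ▸ hc i) hLtop
    exact ratioEquiv_impliedVolatility_simpleVolFormula hκ hτ hv hvσ ha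
      (hκ0.div_atTop ha) hL hd hdL
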